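/- Let $m\ge 2$ and let $f_i(x)=A_ix+b_i$, $i\in I=\{1,\dots,m\}$, be affine maps of $\mathbb{R}^2$ with invertible linear parts $A_i$ of operator norm $\|A_i\|<1$. Let $E$ be the associated self-affine set, i.e. the unique non-empty compact set with $E=\bigcup_{i}f_i(E)$. **Notation.** For a finite word $\mathtt{w}=w_1\cdots w_n$ write $A_{\mathtt w}=A_{w_1}\cdots A_{w_n}$, $f_{\mathtt w}=f_{w_1}\circ\cdots\circ f_{w_n}$ and $E_{\mathtt w}=f_{\mathtt w}(E)$. Let $\alpha_1(\mathtt w)\ge\alpha_2(\mathtt w)$ be the singular values of $A_{\mathtt w}$, and let $\vartheta_1(\mathtt w)=A_{\mathtt w}\eta/\|A_{\mathtt w}\eta\|$, where $\eta$ is a unit eigenvector of $A_{\mathtt w}^TA_{\mathtt w}$ for the eigenvalue $\alpha_1(\mathtt w)^2$ (unique up to sign if $\alpha_1(\mathtt w)>\alpha_2(\mathtt w)$). For $\mathtt i\in I^{\mathbb N}$ let $\mathtt i|_n$ be the word of its first $n$ letters, and let $\pi(\mathtt i)=\sum_{n\ge1}A_{\mathtt i|_{n-1}}b_{i_n}$.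 A unit vector $\overline\vartheta_1(\mathtt i)$ is a limiting direction of $\mathtt i$ if $\vartheta_1(\mathtt i|_n)\to\overline\vartheta_1(\mathtt i)$ for suitable choices of the vectors $\vartheta_1(\mathtt i|_n)$. Let $p=(p_1,\dots,p_m)$ be a probability vector with all $p_i>0$, and let $\nu_p$ be the Bernoulli measure (product measure) on $I^{\mathbb N}$. "For $\nu_p$-almost every $x\in E$" refers to the image measure $\pi_*\nu_p$. The Lyapunov exponents $\lambda_1\le\lambda_2$ are the constants with $-\frac1n\log\alpha_k(\mathtt i|_n)\to\lambda_k$ for $\nu_p$-a.e. $\mathtt i$. All balls $B(x,r)$ are closed. A tangent set of $E$ at $x\in E$ is a non-empty compact set that is the limit in the Hausdorff metric of the sets $\{(y-x)/t_n : y\in E\cap B(x,t_n)\}$ for some $t_n\downarrow0$. A subset $A$ of a metric space is porous if there is $0<\alpha\le1$ such that for every $x\in A$ and $0<r<\operatorname{diam}(A)$ there is a point $y$ of the space with $B(y,\alpha r)\subset B(x,r)\setminus A$. **Theorem.** Suppose that 1. (strong separation) there is $\delta>0$ with $\operatorname{dist}(f_i(E),f_j(E))>\delta$ for all $i\ne j$;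 2. (projection condition) for $\nu_p$-a.e. $\mathtt i\in I^{\mathbb N}$ and each limiting direction $\overline\vartheta_1(\mathtt i)$ there is $n_0\in\mathbb N$ such that for all $n\ge n_0$ and all finite words $\mathtt j$ (including the empty one) the orthogonal projection of $E_{\mathtt i|_n\mathtt j}$ onto the line spanned by $\overline\vartheta_1(\mathtt i)$ is a non-degenerate line segment; 3. $\lambda_1<\lambda_2$. Then for $\nu_p$-a.e. $x\in E$, with $\mathtt i=\pi^{-1}(x)$, the limiting direction $\overline\vartheta_1(\mathtt i)$ exists and, for either choice of its sign, every tangent set of $E$ at $x$ is either of the form $$\mathcal O\big((\mathbb R\times C)\cap B(0,1)\big)\quad\text{with } C\subset\mathbb R \text{ closed and porous (in } \mathbb R),$$ or of the form $$\mathcal O\big((\ell\times\{0\})\cap B(0,1)\big)\quad\text{with } \ell\subset\mathbb R \text{ an interval containing } [-1,0] \text{ or } [0,1],$$ where $\mathcal O$ is the rotation that takes $(1,0)$ to $\overline\vartheta_1(\mathtt i)$. -/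

import Mathlib

open Set Filter Topology MeasureTheory

/-- The Euclidean plane. -/
abbrev Plane : Type := EuclideanSpace ℝ (Fin 2)

/-- An affine iterated function system `f_i(x) = A_i x + b_i`, `i = 1, …, m`, on the plane, with
invertible linear parts of operator norm strictly less than one. -/
structure AffineIFS (m : ℕ) where
  /-- the linear parts `A_i` -/
  linear : Fin m → (Plane →L[ℝ] Plane)
  /-- the translation parts `b_i` -/
  translation : Fin m → Plane
  isUnit_linear : ∀ i, IsUnit (linear i)
  norm_linear_lt_one : ∀ i, ‖linear i‖ < 1

namespace AffineIFS

variable {m : ℕ} (F : AffineIFS m)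

/-- The map `f_i(x) = A_i x + b_i`. -/
def toMap (i : Fin m) (x : Plane) : Plane := F.linear i x + F.translation i

/-- `E` is the self-affine set of the system: the (unique) non-empty compact set with
`E = ⋃ i, f_i(E)`. -/
structure IsSelfAffineSet (E : Set Plane) : Prop where
  isCompact : IsCompact E
  nonempty : E.Nonempty
  eq_iUnion : E = ⋃ i, F.toMap i '' E

/-- For a finite word `w = w_1 ⋯ w_n` the product `A_w = A_{w_1} ⋯ A_{w_n}`. -/
def wordLinear (w : List (Fin m)) : Plane →L[ℝ] Plane := (w.map F.linear).prod

/-- For a finite word `w = w_1 ⋯ w_n` the composition `f_w = f_{w_1} ∘ ⋯ ∘ f_{w_n}`. -/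
def wordMap (w : List (Fin m)) : Plane → Plane := w.foldr (fun i g => F.toMap i ∘ g) id

/-- The construction cylinder `E_w = f_w(E)`. -/
def cylinder (E : Set Plane) (w : List (Fin m)) : Set Plane := F.wordMap w '' E

/-- The initial word `ω|_n`, that is, the first `n` letters of the infinite word `ω`. -/
def initialWord (ω : ℕ → Fin m) (n : ℕ) : List (Fin m) := (List.range n).map ω

/-- The canonical projection `π(ω) = ∑ₙ A_{ω|_n} b_{ω(n+1)}`. Letters of infinite words are
numbered from `0` here. -/
noncomputable def canonicalProjection (ω : ℕ → Fin m) : Plane :=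
  ∑' n, F.wordLinear (initialWord ω n) (F.translation (ω n))

/-- Strong separation: the first level cylinders have mutual distances greater than some
`δ > 0`. -/
def StrongSeparation (E : Set Plane) : Prop :=
  ∃ δ : ℝ, 0 < δ ∧ ∀ i j, i ≠ j → ∀ x ∈ F.toMap i '' E, ∀ y ∈ F.toMap j '' E, δ < dist x y

/-- The singular values of `A_w`, in decreasing order: `α_1(w)` is the value at `k = 0` and
`α_2(w)` is the value at `k = 1`. -/
noncomputable def singularValue (k : Fin 2) (w : List (Fin m)) : ℝ :=
  (F.wordLinear w : Plane →ₗ[ℝ] Plane).singularValues k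

/-- `u` is a choice of the direction `ϑ_1(w) = A_w η / ‖A_w η‖` of the longer semiaxis, where `η` is
a unit eigenvector of `A_wᵀ A_w` with eigenvalue `α_1(w)²`. If `α_1(w) > α_2(w)`, this direction is
unique up to its sign. -/
def IsPrincipalDirection (w : List (Fin m)) (u : Plane) : Prop :=
  ∃ η : Plane, ‖η‖ = 1 ∧
    ContinuousLinearMap.adjoint (F.wordLinear w) (F.wordLinear w η) =
      (F.singularValue 0 w) ^ 2 • η ∧
    u = ‖F.wordLinear w η‖⁻¹ • F.wordLinear w η

/-- `v` is the limiting direction of the infinite word `ω`: with suitable choices of `ϑ_1(ω|_n)` one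
has `ϑ_1(ω|_n) → v`. -/
def IsLimitDirection (ω : ℕ → Fin m) (v : Plane) : Prop :=
  ∃ u : ℕ → Plane, (∀ n, F.IsPrincipalDirection (initialWord ω n) (u n)) ∧
    Tendsto u atTop (𝓝 v)

/-- The Bernoulli measure `ν_p` on infinite words: the product of the probability vector `p`. -/
noncomputable def bernoulliMeasure (p : PMF (Fin m)) : Measure (ℕ → Fin m) :=
  Measure.infinitePi fun _ : ℕ => p.toMeasure

/-- For `ν_p`-almost every `ω` the sequence `-(1/n) log α_{k+1}(ω|_n)` converges to `c`. -/
def IsLyapunovExponent (p : PMF (Fin m)) (k : Fin 2) (c : ℝ) : Prop :=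
  ∀ᵐ ω ∂(bernoulliMeasure p),
    Tendsto (fun n : ℕ => -(1 / (n : ℝ)) * Real.log (F.singularValue k (initialWord ω n)))
      atTop (𝓝 c)

open Classical in
/-- The Lyapunov exponents of `ν_p`: the constants `λ_1` (`k = 0`) and `λ_2` (`k = 1`) with
`-(1/n) log α_{k+1}(ω|_n) → λ_{k+1}` for `ν_p`-almost every `ω`. They exist by the subadditive
ergodic theorem, so that the second alternative never applies. -/
noncomputable def lyapunovExponent (p : PMF (Fin m)) (k : Fin 2) : ℝ :=
  if h : ∃ c : ℝ, F.IsLyapunovExponent p k c then h.choose else 0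

end AffineIFS

/-- `S` is a (non-degenerate, compact) line segment. -/
def IsLineSegment (S : Set Plane) : Prop := ∃ a b : Plane, a ≠ b ∧ S = segment ℝ a b

/-- The orthogonal projection of `S` onto the line spanned by `v`. -/
noncomputable def projOnto (v : Plane) (S : Set Plane) : Set Plane :=
  (Submodule.span ℝ {v}).starProjection '' S

/-- The scenery of `E` around `x` at scale `t`: the part of `E` in the closed ball `B(x, t)`,
magnified by `y ↦ (y - x) / t`. -/
def scenery (E : Set Plane) (x : Plane) (t : ℝ) : Set Plane :=
  (fun y => t⁻¹ • (y - x)) '' (E ∩ Metric.closedBall x t)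

/-- `T` is a tangent set of `E` at `x`: a limit, in the Hausdorff metric on non-empty compact sets,
of sceneries of `E` around `x` along some scales `t_n ↓ 0`. -/
def IsTangentSet (E : Set Plane) (x : Plane) (T : Set Plane) : Prop :=
  IsCompact T ∧ T.Nonempty ∧ ∃ t : ℕ → ℝ, (∀ n, 0 < t n) ∧ Antitone t ∧ Tendsto t atTop (𝓝 0) ∧
    Tendsto (fun n => Metric.hausdorffEDist (scenery E x (t n)) T) atTop (𝓝 0)

/-- (Uniformly lower) porous sets: for some `0 < α ≤ 1`, every ball `B(x, r)` with `x ∈ A` and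
`0 < r < diam A` contains a ball of radius `α r` that misses `A`. The diameter is the extended one,
so that it is infinite for unbounded sets. -/
def IsPorous {X : Type*} [MetricSpace X] (A : Set X) : Prop :=
  ∃ α : ℝ, 0 < α ∧ α ≤ 1 ∧ ∀ x ∈ A, ∀ r : ℝ, 0 < r → ENNReal.ofReal r < Metric.ediam A →
    ∃ y : X, Metric.closedBall y (α * r) ⊆ Metric.closedBall x r \ A

/-- For a unit vector `v`, the rotation of the plane that takes `(1, 0)` to `v`. -/
noncomputable def rotationTo (v : Plane) : Plane →ₗ[ℝ] Plane :=
  Matrix.toEuclideanLin !![v 0, -v 1; v 1, v 0]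

/-- The product `S₁ × S₂` of two subsets of the line, as a subset of the plane. -/
def planeProd (S₁ S₂ : Set ℝ) : Set Plane := {z | z 0 ∈ S₁ ∧ z 1 ∈ S₂}

/-!
For almost every infinite word `ω` the tangent sets at `π(ω)` turn out to be fibred over a porous
set, so that the first alternative of the theorem holds.

Since the Lyapunov exponents differ, the eccentricity `α₂ / α₁` of the words `ω|ₙ` decays
exponentially (`AffineIFS.ae_eventually_eccentricity_le`). The angles between consecutive principal
directions are at most a constant times the eccentricity, so that a limiting direction `v` exists
(`AffineIFS.exists_isLimitDirection`). By strong separation, the part of `E` in a small ball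
`B(π(ω), t)` belongs to one cylinder `f_{ω|ₙ}(E)` with `α₂(ω|ₙ)` comparable to `t`, and the preimage
of the ball under `f_{ω|ₙ}` is a strip around the point `π(σⁿω)`, across the long axis of `ω|ₙ`,
whose relative width is comparable to the eccentricity. Consider the finitely many cylinders `E_j`
of a fixed level. Projected to the long axis direction, they are nearly segments by the projection
condition, and hence they either cross the strip, or miss it, or end inside it. The last case is
excluded almost surely for large `n`:

* `E` is not contained in a line, because on a line the projections of its cylinders would be
  disconnected (`AffineIFS.exists_planeCross_ne_zero`). Hence it has positive width in all
  directions, and a narrow strip misses a cylinder of some fixed level. By self-similarity,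
  the measures of strips decay like a power of their widths
  (`AffineIFS.exists_measure_stripWords_le`).
* The direction of the strip and the ends of the projected cylinders depend on the first `n`
  letters, while the point `π(σⁿω)` depends on the other ones. So the probabilities that an end is
  within the strip are summable, and the Borel–Cantelli lemma applies
  (`AffineIFS.ae_eventually_noEndNear`).

Thus every point of `E ∩ B(π(ω), t)` lies in a piece `f_{ω|ₙ}(E_j)` that crosses the whole ball in
the direction `v`, and the height of this piece inside the ball is a small multiple of `t`
(`AffineIFS.IsTypical.eventually_crossing`). In the limit, tangent sets contain the whole chord
through each of their points (`AffineIFS.IsTypical.mem_tangent`).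

The fibre `C` is porous because of strong separation. At a height in `C` and a scale `r`, the
relevant cylinder `f_w(E)` is the one with `α₂(w)` comparable to `r t`. Its subcylinders of a fixed
high relative level have heights much smaller than `r t`, but mutual distances at least `κ r t` for
some constant `κ`. If `C` had no holes of size comparable to `κ r`, then a chain of points with
smaller steps would have to remain in one subcylinder, yet climb higher than this subcylinder
(`AffineIFS.IsTypical.exists_chain_bound`, `AffineIFS.IsTypical.isPorous_fibre`).
-/

/-! ### Coordinates in a rotated frame -/

/-- The signed area `x₀ y₁ - x₁ y₀` of the parallelogram spanned by two vectors of the plane. For a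
unit vector `v`, the numbers `⟪v, z⟫` and `planeCross v z` are the coordinates of `z` in the
positively oriented orthonormal frame that starts with `v`. -/
def planeCross (x y : Plane) : ℝ := x 0 * y 1 - x 1 * y 0

theorem plane_inner_eq (x y : Plane) : inner ℝ x y = x 0 * y 0 + x 1 * y 1 := by
  simp [PiLp.inner_apply, Fin.sum_univ_two, mul_comm]

theorem plane_norm_sq (x : Plane) : ‖x‖ ^ 2 = x 0 ^ 2 + x 1 ^ 2 := by
  simp [EuclideanSpace.norm_sq_eq, Fin.sum_univ_two]

theorem inner_sq_add_planeCross_sq (x y : Plane) :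
    (inner ℝ x y : ℝ) ^ 2 + planeCross x y ^ 2 = ‖x‖ ^ 2 * ‖y‖ ^ 2 := by
  rw [plane_inner_eq, plane_norm_sq, plane_norm_sq, planeCross]; ring

theorem abs_planeCross_le (x y : Plane) : |planeCross x y| ≤ ‖x‖ * ‖y‖ := by
  apply abs_le_of_sq_le_sq _ (by positivity)
  nlinarith [inner_sq_add_planeCross_sq x y, sq_nonneg (inner ℝ x y : ℝ)]

theorem planeCross_sub_right (x y z : Plane) :
    planeCross x (y - z) = planeCross x y - planeCross x z := by
  simp [planeCross]; ring

theorem planeCross_smul_right (c : ℝ) (x y : Plane) :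
    planeCross x (c • y) = c * planeCross x y := by
  simp [planeCross]; ring

theorem planeCross_smul_left (c : ℝ) (x y : Plane) :
    planeCross (c • x) y = c * planeCross x y := by
  simp [planeCross]; ring

theorem planeCross_self (x : Plane) : planeCross x x = 0 := by
  simp [planeCross]; ring

/-- The change of frame for the second coordinate. -/
theorem planeCross_eq_of_norm_eq_one {u : Plane} (hu : ‖u‖ = 1) (v p : Plane) :
    planeCross v p = inner ℝ u v * planeCross u p - planeCross u v * inner ℝ u p := by
  have h := plane_norm_sq u
  rw [hu] at h
  rw [plane_inner_eq, plane_inner_eq, planeCross, planeCross, planeCross]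
  linear_combination (v 0 * p 1 - v 1 * p 0) * h

/-- The change of frame for the first coordinate. -/
theorem plane_inner_eq_of_norm_eq_one {u : Plane} (hu : ‖u‖ = 1) (v p : Plane) :
    (inner ℝ v p : ℝ) = inner ℝ u v * inner ℝ u p + planeCross u v * planeCross u p := by
  have h := plane_norm_sq u
  rw [hu] at h
  rw [plane_inner_eq, plane_inner_eq, plane_inner_eq, planeCross, planeCross]
  linear_combination (v 0 * p 0 + v 1 * p 1) * h

theorem planeCross_map (A : Plane →ₗ[ℝ] Plane) (x y : Plane) :
    planeCross (A x) (A y) = LinearMap.det A * planeCross x y := by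
  obtain ⟨M, rfl⟩ : ∃ M : Matrix (Fin 2) (Fin 2) ℝ, A = Matrix.toEuclideanLin M :=
    ⟨Matrix.toEuclideanLin.symm A, by simp⟩
  have hdet : LinearMap.det (Matrix.toEuclideanLin M) = M.det := by
    rw [← LinearMap.det_toLin (PiLp.basisFun 2 ℝ (Fin 2)) M, ← Matrix.toLpLin_eq_toLin]
  rw [hdet, Matrix.det_fin_two]
  simp [planeCross, Matrix.toLpLin_apply]
  ring

theorem continuous_planeCross (v : Plane) : Continuous (planeCross v) := by
  unfold planeCross; fun_prop

theorem norm_sub_le_of_inner_nonneg {u v : Plane} (hu : ‖u‖ = 1) (hv : ‖v‖ = 1)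
    (h : 0 ≤ (inner ℝ u v : ℝ)) : ‖u - v‖ ≤ 2 * |planeCross u v| := by
  apply le_of_sq_le_sq _ (by positivity)
  have e := inner_sq_add_planeCross_sq u v
  have e2 := norm_sub_sq_real u v
  rw [hu, hv] at e e2
  rw [mul_pow, sq_abs, e2]
  nlinarith

theorem abs_planeCross_le_one {u v : Plane} (hu : ‖u‖ = 1) (hv : ‖v‖ = 1) :
    |planeCross u v| ≤ 1 := by
  simpa [hu, hv] using abs_planeCross_le u v

theorem abs_inner_le_one {u v : Plane} (hu : ‖u‖ = 1) (hv : ‖v‖ = 1) :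
    |(inner ℝ u v : ℝ)| ≤ 1 := by
  simpa [hu, hv] using abs_real_inner_le_norm u v

theorem half_le_abs_inner {u v : Plane} (hu : ‖u‖ = 1) (hv : ‖v‖ = 1)
    (h : |planeCross u v| ≤ 1 / 2) : 1 / 2 ≤ |(inner ℝ u v : ℝ)| := by
  have e := inner_sq_add_planeCross_sq u v
  rw [hu, hv, ← sq_abs (inner ℝ u v : ℝ), ← sq_abs (planeCross u v)] at e
  nlinarith [abs_nonneg (inner ℝ u v : ℝ), abs_nonneg (planeCross u v)]

theorem norm_sq_eq_inner_sq_add {v : Plane} (hv : ‖v‖ = 1) (w : Plane) :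
    ‖w‖ ^ 2 = (inner ℝ v w : ℝ) ^ 2 + planeCross v w ^ 2 := by
  rw [inner_sq_add_planeCross_sq, hv, one_pow, one_mul]

theorem norm_le_abs_inner_add {v : Plane} (hv : ‖v‖ = 1) (w : Plane) :
    ‖w‖ ≤ |(inner ℝ v w : ℝ)| + |planeCross v w| := by
  refine abs_le_of_sq_le_sq' ?_ (by positivity) |>.2
  rw [norm_sq_eq_inner_sq_add hv, ← sq_abs (inner ℝ v w : ℝ), ← sq_abs (planeCross v w)]
  nlinarith [abs_nonneg (inner ℝ v w : ℝ), abs_nonneg (planeCross v w)]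

theorem rotationTo_apply_zero (v z : Plane) : rotationTo v z 0 = v 0 * z 0 - v 1 * z 1 := by
  simp [rotationTo, Matrix.toLpLin_apply, Matrix.vecHead, Matrix.vecTail]
  ring

theorem rotationTo_apply_one (v z : Plane) : rotationTo v z 1 = v 1 * z 0 + v 0 * z 1 := by
  simp [rotationTo, Matrix.toLpLin_apply, Matrix.vecHead, Matrix.vecTail]

theorem inner_rotationTo {v : Plane} (hv : ‖v‖ = 1) (z : Plane) :
    (inner ℝ v (rotationTo v z) : ℝ) = z 0 := by
  have h := plane_norm_sq v
  rw [hv] at h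
  rw [plane_inner_eq, rotationTo_apply_zero, rotationTo_apply_one]
  linear_combination -z 0 * h

theorem planeCross_rotationTo {v : Plane} (hv : ‖v‖ = 1) (z : Plane) :
    planeCross v (rotationTo v z) = z 1 := by
  have h := plane_norm_sq v
  rw [hv] at h
  rw [planeCross, rotationTo_apply_zero, rotationTo_apply_one]
  linear_combination -z 1 * h

theorem rotationTo_frame {v : Plane} (hv : ‖v‖ = 1) (w : Plane) :
    rotationTo v !₂[inner ℝ v w, planeCross v w] = w := by
  have h := plane_norm_sq v
  rw [hv] at h
  ext k
  fin_cases k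
  · simp only [Fin.zero_eta, rotationTo_apply_zero]
    simp only [planeCross, plane_inner_eq, Matrix.cons_val_zero,
      Matrix.cons_val_one]
    linear_combination -w 0 * h
  · simp only [Fin.mk_one, rotationTo_apply_one]
    simp only [planeCross, plane_inner_eq, Matrix.cons_val_zero,
      Matrix.cons_val_one]
    linear_combination -w 1 * h

/-! ### Singular values of a linear map of the plane -/

/-- The singular value decomposition in the plane. -/
theorem exists_singular_frame (A : Plane →L[ℝ] Plane) :
    ∃ e : OrthonormalBasis (Fin 2) ℝ Plane, ∀ k,
      ContinuousLinearMap.adjoint A (A (e k)) =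
        ((A : Plane →ₗ[ℝ] Plane).singularValues k) ^ 2 • e k := by
  set T : Plane →ₗ[ℝ] Plane := A.toLinearMap with hT
  have hn : Module.finrank ℝ Plane = 2 := by simp
  refine ⟨T.isSymmetric_adjoint_comp_self.eigenvectorBasis hn, fun k => ?_⟩
  have h := T.isSymmetric_adjoint_comp_self.apply_eigenvectorBasis hn k
  rw [T.sq_singularValues_fin hn k]
  exact h

section
variable (A : Plane →L[ℝ] Plane)

local notation "σ" => (LinearMap.singularValues (A : Plane →ₗ[ℝ] Plane))

theorem inner_map_singular_frame {η : Plane} {c : ℝ}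
    (h : ContinuousLinearMap.adjoint A (A η) = c • η) (y : Plane) :
    (inner ℝ (A η) (A y) : ℝ) = c * inner ℝ η y := by
  rw [← ContinuousLinearMap.adjoint_inner_left, h, real_inner_smul_left]

theorem norm_sq_map_eq (e : OrthonormalBasis (Fin 2) ℝ Plane)
    (he : ∀ k : Fin 2, ContinuousLinearMap.adjoint A (A (e k)) = (σ k) ^ 2 • e k) (y : Plane) :
    ‖A y‖ ^ 2 = (σ 0) ^ 2 * (inner ℝ (e 0) y : ℝ) ^ 2 + (σ 1) ^ 2 * (inner ℝ (e 1) y : ℝ) ^ 2 := by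
  have h0 := inner_map_singular_frame A (he 0) y
  have h1 := inner_map_singular_frame A (he 1) y
  have hy : y = (inner ℝ (e 0) y : ℝ) • e 0 + (inner ℝ (e 1) y : ℝ) • e 1 := by
    have := e.sum_repr' y
    rw [Fin.sum_univ_two] at this
    exact this.symm
  rw [← real_inner_self_eq_norm_sq]
  have : (inner ℝ (A y) (A y) : ℝ)
      = inner ℝ (A ((inner ℝ (e 0) y : ℝ) • e 0 + (inner ℝ (e 1) y : ℝ) • e 1)) (A y) := by
    rw [← hy]
  rw [this, map_add, map_smul, map_smul, inner_add_left, real_inner_smul_left,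
    real_inner_smul_left, h0, h1]
  simp
  ring

theorem norm_sq_eq_frame (e : OrthonormalBasis (Fin 2) ℝ Plane) (y : Plane) :
    ‖y‖ ^ 2 = (inner ℝ (e 0) y : ℝ) ^ 2 + (inner ℝ (e 1) y : ℝ) ^ 2 := by
  have := e.sum_sq_norm_inner_right y
  rw [Fin.sum_univ_two] at this
  simp only [Real.norm_eq_abs, sq_abs] at this
  exact this.symm

theorem norm_map_le_singularValue (y : Plane) : ‖A y‖ ≤ σ 0 * ‖y‖ := by
  obtain ⟨e, he⟩ := exists_singular_frame A
  have hn := LinearMap.singularValues_nonneg (A : Plane →ₗ[ℝ] Plane)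
  have h01 : σ 1 ≤ σ 0 := LinearMap.singularValues_antitone _ zero_le_one
  apply le_of_sq_le_sq _ (mul_nonneg (hn 0) (norm_nonneg _))
  rw [norm_sq_map_eq A e he, mul_pow, norm_sq_eq_frame e y]
  have : (σ 1) ^ 2 ≤ (σ 0) ^ 2 := pow_le_pow_left₀ (hn 1) h01 2
  nlinarith [mul_le_mul_of_nonneg_right this (sq_nonneg (inner ℝ (e 1) y : ℝ))]

theorem singularValue_le_norm_map (y : Plane) : σ 1 * ‖y‖ ≤ ‖A y‖ := by
  obtain ⟨e, he⟩ := exists_singular_frame A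
  have hn := LinearMap.singularValues_nonneg (A : Plane →ₗ[ℝ] Plane)
  have h01 : σ 1 ≤ σ 0 := LinearMap.singularValues_antitone _ zero_le_one
  apply le_of_sq_le_sq _ (norm_nonneg _)
  rw [norm_sq_map_eq A e he, mul_pow, norm_sq_eq_frame e y]
  have : (σ 1) ^ 2 ≤ (σ 0) ^ 2 := pow_le_pow_left₀ (hn 1) h01 2
  nlinarith [mul_le_mul_of_nonneg_right this (sq_nonneg (inner ℝ (e 0) y : ℝ))]

theorem norm_map_of_adjoint_eq {η : Plane} {c : ℝ} (hc : 0 ≤ c) (hη : ‖η‖ = 1)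
    (h : ContinuousLinearMap.adjoint A (A η) = c ^ 2 • η) : ‖A η‖ = c := by
  have := inner_map_singular_frame A h η
  rw [real_inner_self_eq_norm_sq, real_inner_self_eq_norm_sq, hη, one_pow, mul_one] at this
  exact (pow_left_inj₀ (norm_nonneg _) hc two_ne_zero).1 this

theorem exists_norm_map_eq_singularValue (k : Fin 2) : ∃ η : Plane, ‖η‖ = 1 ∧ ‖A η‖ = σ k := by
  obtain ⟨e, he⟩ := exists_singular_frame A
  have hn := LinearMap.singularValues_nonneg (A : Plane →ₗ[ℝ] Plane)
  exact ⟨e k, e.norm_eq_one k, norm_map_of_adjoint_eq A (hn k) (e.norm_eq_one k) (he k)⟩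

theorem singularValue_mul_eq_abs_det : σ 0 * σ 1 = |LinearMap.det (A : Plane →ₗ[ℝ] Plane)| := by
  obtain ⟨e, he⟩ := exists_singular_frame A
  have hn := LinearMap.singularValues_nonneg (A : Plane →ₗ[ℝ] Plane)
  have h01 : (inner ℝ (e 0) (e 1) : ℝ) = 0 := e.orthonormal.inner_eq_zero (by simp)
  have n0 := norm_map_of_adjoint_eq A (hn _) (e.norm_eq_one 0) (he 0)
  have n1 := norm_map_of_adjoint_eq A (hn _) (e.norm_eq_one 1) (he 1)
  have hc := inner_sq_add_planeCross_sq (e 0) (e 1)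
  have hd := inner_sq_add_planeCross_sq (A (e 0)) (A (e 1))
  have hm := planeCross_map (A : Plane →ₗ[ℝ] Plane) (e 0) (e 1)
  simp only [ContinuousLinearMap.coe_coe] at hm
  rw [inner_map_singular_frame A (he 0), h01, hm, n0, n1] at hd
  rw [h01, e.norm_eq_one, e.norm_eq_one] at hc
  rw [← abs_of_nonneg (mul_nonneg (hn 0) (hn 1)), ← sq_eq_sq_iff_abs_eq_abs]
  rw [mul_pow] at hd
  simp only [Fin.val_zero, Fin.val_one] at hd
  linear_combination -hd + LinearMap.det (A : Plane →ₗ[ℝ] Plane) ^ 2 * hc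

/-- The image of the plane is thin transversally to the principal direction `A η / σ₀`. -/
theorem abs_planeCross_map_le {η : Plane} (hη : ‖η‖ = 1) (h0 : 0 < σ 0) (y : Plane) :
    |planeCross ((σ 0)⁻¹ • A η) (A y)| ≤ σ 1 * ‖y‖ := by
  have hm := planeCross_map (A : Plane →ₗ[ℝ] Plane) η y
  simp only [ContinuousLinearMap.coe_coe] at hm
  rw [planeCross_smul_left, hm, abs_mul, abs_mul, ← singularValue_mul_eq_abs_det, abs_inv,
    abs_of_pos h0, ← mul_assoc, inv_mul_cancel_left₀ h0.ne']
  have := abs_planeCross_le η y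
  rw [hη, one_mul] at this
  exact mul_le_mul_of_nonneg_left this (LinearMap.singularValues_nonneg _ _)

end

/-! ### Finite words -/

namespace AffineIFS

variable {m : ℕ} (F : AffineIFS m)

@[simp] theorem wordLinear_nil : F.wordLinear [] = 1 := rfl

@[simp] theorem wordLinear_cons (i : Fin m) (w : List (Fin m)) :
    F.wordLinear (i :: w) = F.linear i * F.wordLinear w := by
  simp [wordLinear]

theorem wordLinear_append (w w' : List (Fin m)) :
    F.wordLinear (w ++ w') = F.wordLinear w * F.wordLinear w' := by
  simp [wordLinear]

@[simp] theorem wordMap_nil : F.wordMap [] = id := rfl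

@[simp] theorem wordMap_cons (i : Fin m) (w : List (Fin m)) :
    F.wordMap (i :: w) = F.toMap i ∘ F.wordMap w := rfl

theorem wordMap_append (w w' : List (Fin m)) :
    F.wordMap (w ++ w') = F.wordMap w ∘ F.wordMap w' := by
  induction w with
  | nil => rfl
  | cons i w ih => rw [List.cons_append, wordMap_cons, ih, wordMap_cons, Function.comp_assoc]

theorem wordMap_sub (w : List (Fin m)) (y z : Plane) :
    F.wordMap w y - F.wordMap w z = F.wordLinear w (y - z) := by
  induction w with
  | nil => simp
  | cons i w ih =>
    simp only [wordMap_cons, Function.comp_apply, toMap, wordLinear_cons, mul_apply_eq_comp]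
    rw [← ih, map_sub]
    abel

theorem isUnit_wordLinear (w : List (Fin m)) : IsUnit (F.wordLinear w) := by
  induction w with
  | nil => simp
  | cons i w ih => rw [wordLinear_cons]; exact (F.isUnit_linear i).mul ih

theorem wordLinear_surjective (w : List (Fin m)) : Function.Surjective (F.wordLinear w) := by
  obtain ⟨U, hU⟩ := F.isUnit_wordLinear w
  intro y
  refine ⟨(↑U⁻¹ : Plane →L[ℝ] Plane) y, ?_⟩
  rw [← hU, ← mul_apply_eq_comp, Units.mul_inv, one_apply_eq_self]

theorem wordLinear_injective (w : List (Fin m)) : Function.Injective (F.wordLinear w) := by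
  obtain ⟨U, hU⟩ := F.isUnit_wordLinear w
  intro y z h
  have := congrArg (↑U⁻¹ : Plane →L[ℝ] Plane) h
  rwa [← hU, ← mul_apply_eq_comp, ← mul_apply_eq_comp, Units.inv_mul] at this

theorem continuous_wordMap (w : List (Fin m)) : Continuous (F.wordMap w) := by
  have : F.wordMap w = fun y => F.wordLinear w y + F.wordMap w 0 := by
    funext y
    rw [← sub_eq_iff_eq_add, wordMap_sub, sub_zero]
  rw [this]
  fun_prop

/-! ### Singular values along words -/

theorem singularValue_nonneg (k : Fin 2) (w : List (Fin m)) : 0 ≤ F.singularValue k w :=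
  LinearMap.singularValues_nonneg _ _

theorem norm_wordLinear_apply_le (w : List (Fin m)) (y : Plane) :
    ‖F.wordLinear w y‖ ≤ F.singularValue 0 w * ‖y‖ :=
  norm_map_le_singularValue _ _

theorem le_norm_wordLinear_apply (w : List (Fin m)) (y : Plane) :
    F.singularValue 1 w * ‖y‖ ≤ ‖F.wordLinear w y‖ :=
  singularValue_le_norm_map _ _

theorem singularValue_mul (w : List (Fin m)) :
    F.singularValue 0 w * F.singularValue 1 w =
      |LinearMap.det (F.wordLinear w : Plane →ₗ[ℝ] Plane)| :=
  singularValue_mul_eq_abs_det _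

theorem exists_norm_wordLinear_apply_eq (k : Fin 2) (w : List (Fin m)) :
    ∃ η : Plane, ‖η‖ = 1 ∧ ‖F.wordLinear w η‖ = F.singularValue k w :=
  exists_norm_map_eq_singularValue _ k

theorem singularValue_pos (k : Fin 2) (w : List (Fin m)) : 0 < F.singularValue k w := by
  obtain ⟨η, hη, h⟩ := F.exists_norm_wordLinear_apply_eq k w
  rw [← h, norm_pos_iff]
  intro h0
  have : η = 0 := F.wordLinear_injective w (h0.trans (map_zero _).symm)
  simp [this] at hη

theorem singularValue_one_mul_le_append (w w' : List (Fin m)) :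
    F.singularValue 1 w * F.singularValue 1 w' ≤ F.singularValue 1 (w ++ w') := by
  obtain ⟨η, hη, h⟩ := F.exists_norm_wordLinear_apply_eq 1 (w ++ w')
  rw [← h, wordLinear_append, mul_apply_eq_comp]
  refine le_trans ?_ (F.le_norm_wordLinear_apply w _)
  have := F.le_norm_wordLinear_apply w' η
  rw [hη, mul_one] at this
  exact mul_le_mul_of_nonneg_left this (F.singularValue_nonneg _ _)

theorem singularValue_one_append_le (w w' : List (Fin m)) :
    F.singularValue 1 (w ++ w') ≤ F.singularValue 1 w * F.singularValue 0 w' := by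
  obtain ⟨η, hη, h⟩ := F.exists_norm_wordLinear_apply_eq 1 w
  obtain ⟨y, rfl⟩ := F.wordLinear_surjective w' η
  have h1 := F.le_norm_wordLinear_apply (w ++ w') y
  rw [wordLinear_append, mul_apply_eq_comp, h] at h1
  have h2 := F.norm_wordLinear_apply_le w' y
  rw [hη] at h2
  have h3 : 0 < ‖y‖ := by
    rw [norm_pos_iff]; rintro rfl; simp at hη
  refine le_of_mul_le_mul_right (h1.trans ?_) h3
  nlinarith [mul_le_mul_of_nonneg_left h2 (F.singularValue_nonneg 1 w)]

theorem singularValue_zero_mul_le_append (w w' : List (Fin m)) :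
    F.singularValue 0 w * F.singularValue 1 w' ≤ F.singularValue 0 (w ++ w') := by
  obtain ⟨η, hη, h⟩ := F.exists_norm_wordLinear_apply_eq 0 w
  obtain ⟨y, rfl⟩ := F.wordLinear_surjective w' η
  have h1 := F.norm_wordLinear_apply_le (w ++ w') y
  rw [wordLinear_append, mul_apply_eq_comp, h] at h1
  have h2 := F.le_norm_wordLinear_apply w' y
  rw [hη] at h2
  have h3 : 0 < ‖y‖ := by
    rw [norm_pos_iff]; rintro rfl; simp at hη
  refine le_of_mul_le_mul_right (le_trans ?_ h1) h3
  nlinarith [mul_le_mul_of_nonneg_left h2 (F.singularValue_nonneg 0 w)]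

theorem norm_wordLinear_le_pow {β : ℝ} (hβ0 : 0 ≤ β) (hβ : ∀ i, ‖F.linear i‖ ≤ β)
    (w : List (Fin m)) : ‖F.wordLinear w‖ ≤ β ^ w.length := by
  induction w with
  | nil => simp
  | cons i w ih =>
    rw [wordLinear_cons, List.length_cons, pow_succ']
    exact (norm_mul_le _ _).trans (mul_le_mul (hβ i) ih (norm_nonneg _) hβ0)

theorem singularValue_zero_le_pow {β : ℝ} (hβ0 : 0 ≤ β) (hβ : ∀ i, ‖F.linear i‖ ≤ β)
    (w : List (Fin m)) : F.singularValue 0 w ≤ β ^ w.length := by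
  obtain ⟨η, hη, h⟩ := F.exists_norm_wordLinear_apply_eq 0 w
  rw [← h]
  refine ((F.wordLinear w).le_opNorm η).trans ?_
  rw [hη, mul_one]
  exact F.norm_wordLinear_le_pow hβ0 hβ w

theorem singularValue_nil (k : Fin 2) : F.singularValue k [] = 1 := by
  obtain ⟨η, hη, h⟩ := F.exists_norm_wordLinear_apply_eq k []
  rw [← h]; simpa using hη

theorem pow_le_singularValue_one {a : ℝ} (ha0 : 0 ≤ a) (ha : ∀ i, a ≤ F.singularValue 1 [i])
    (w : List (Fin m)) : a ^ w.length ≤ F.singularValue 1 w := by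
  induction w with
  | nil => simp [singularValue_nil]
  | cons i w ih =>
    rw [List.length_cons, pow_succ', ← List.singleton_append]
    refine le_trans ?_ (F.singularValue_one_mul_le_append [i] w)
    exact mul_le_mul (ha i) ih (pow_nonneg ha0 _) (F.singularValue_nonneg _ _)

/-- Uniform bounds for the contraction ratios of the maps of the system. -/
theorem exists_ratio_bounds : ∃ a β : ℝ, 0 < a ∧ a < 1 ∧ 0 < β ∧ β < 1 ∧
    (∀ i, a ≤ F.singularValue 1 [i]) ∧ ∀ i, ‖F.linear i‖ ≤ β := by
  have h1 : ∀ᶠ a in 𝓝[>] (0 : ℝ), (0 < a ∧ a < 1) ∧ ∀ i, a ≤ F.singularValue 1 [i] := by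
    refine Eventually.and (Ioo_mem_nhdsGT one_pos) (eventually_all.2 fun i => ?_)
    filter_upwards [Ioo_mem_nhdsGT (F.singularValue_pos 1 [i])] with a ha using ha.2.le
  have h2 : ∀ᶠ b in 𝓝[<] (1 : ℝ), (0 < b ∧ b < 1) ∧ ∀ i, ‖F.linear i‖ ≤ b := by
    refine Eventually.and (Ioo_mem_nhdsLT one_pos) (eventually_all.2 fun i => ?_)
    filter_upwards [Ioo_mem_nhdsLT (F.norm_linear_lt_one i)] with a ha using ha.1.le
  obtain ⟨a, ⟨ha0, ha1⟩, ha⟩ := h1.exists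
  obtain ⟨b, ⟨hb0, hb1⟩, hb⟩ := h2.exists
  exact ⟨a, b, ha0, ha1, hb0, hb1, ha, hb⟩

/-! ### Infinite words and the canonical projection -/

/-- The infinite word `ω` without its first `n` letters. -/
def shiftWord (n : ℕ) (ω : ℕ → Fin m) : ℕ → Fin m := fun k => ω (k + n)

/-- The infinite word `i ω`. -/
def consWord (i : Fin m) (ω : ℕ → Fin m) : ℕ → Fin m
  | 0 => i
  | k + 1 => ω k

/-- The infinite word `w ω`. -/
def prependWord (w : List (Fin m)) (ω : ℕ → Fin m) : ℕ → Fin m := w.foldr consWord ω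

@[simp] theorem initialWord_zero (ω : ℕ → Fin m) : initialWord ω 0 = [] := rfl

@[simp] theorem length_initialWord (ω : ℕ → Fin m) (n : ℕ) : (initialWord ω n).length = n := by
  simp [initialWord]

theorem initialWord_succ (ω : ℕ → Fin m) (n : ℕ) :
    initialWord ω (n + 1) = initialWord ω n ++ [ω n] := by
  simp [initialWord, List.range_succ]

theorem initialWord_succ' (ω : ℕ → Fin m) (n : ℕ) :
    initialWord ω (n + 1) = ω 0 :: initialWord (shiftWord 1 ω) n := by
  simp only [initialWord, List.range_succ_eq_map, List.map_cons, List.map_map]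
  rfl

theorem shiftWord_shiftWord (n k : ℕ) (ω : ℕ → Fin m) :
    shiftWord k (shiftWord n ω) = shiftWord (n + k) ω := by
  funext l; simp only [shiftWord]; congr 1; omega

theorem initialWord_add (ω : ℕ → Fin m) (n k : ℕ) :
    initialWord ω (n + k) = initialWord ω n ++ initialWord (shiftWord n ω) k := by
  induction k with
  | zero => simp
  | succ k ih =>
    rw [← add_assoc, initialWord_succ, ih, initialWord_succ, List.append_assoc]
    simp only [shiftWord, add_comm k n]

theorem initialWord_prependWord (w : List (Fin m)) (ω : ℕ → Fin m) :
    initialWord (prependWord w ω) w.length = w := by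
  induction w with
  | nil => rfl
  | cons i w ih => rw [List.length_cons, initialWord_succ']; exact congrArg (i :: ·) ih

theorem shiftWord_prependWord (w : List (Fin m)) (ω : ℕ → Fin m) :
    shiftWord w.length (prependWord w ω) = ω := by
  induction w with
  | nil => rfl
  | cons i w ih => exact ih

theorem summable_canonicalProjection (ω : ℕ → Fin m) :
    Summable fun n => F.wordLinear (initialWord ω n) (F.translation (ω n)) := by
  obtain ⟨a, β, -, -, hβ0, hβ1, -, hβ⟩ := F.exists_ratio_bounds
  refine Summable.of_norm_bounded
    (g := fun n => β ^ n * ∑ i, ‖F.translation i‖)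
    ((summable_geometric_of_lt_one hβ0.le hβ1).mul_right _) fun n => ?_
  refine (ContinuousLinearMap.le_opNorm _ _).trans (mul_le_mul ?_ ?_ (norm_nonneg _) (by positivity))
  · simpa using F.norm_wordLinear_le_pow hβ0.le hβ (initialWord ω n)
  · exact Finset.single_le_sum (f := fun i => ‖F.translation i‖) (fun i _ => norm_nonneg _)
      (Finset.mem_univ _)

theorem continuous_wordLinear_initialWord (n : ℕ) :
    Continuous fun ω : ℕ → Fin m => F.wordLinear (initialWord ω n) := by
  induction n with
  | zero => exact continuous_const
  | succ n ih =>
    simp only [initialWord_succ, wordLinear_append]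
    exact ih.mul ((continuous_of_discreteTopology (f := fun i => F.wordLinear [i])).comp
      (continuous_apply n))

theorem continuous_canonicalProjection : Continuous F.canonicalProjection := by
  obtain ⟨a, β, -, -, hβ0, hβ1, -, hβ⟩ := F.exists_ratio_bounds
  refine continuous_tsum (u := fun n => β ^ n * ∑ i, ‖F.translation i‖) (fun n => ?_)
    ((summable_geometric_of_lt_one hβ0.le hβ1).mul_right _) fun n ω => ?_
  · exact (F.continuous_wordLinear_initialWord n).clm_apply
      ((continuous_of_discreteTopology (f := F.translation)).comp (continuous_apply n))
  · refine (ContinuousLinearMap.le_opNorm _ _).trans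
      (mul_le_mul ?_ ?_ (norm_nonneg _) (by positivity))
    · simpa using F.norm_wordLinear_le_pow hβ0.le hβ (initialWord ω n)
    · exact Finset.single_le_sum (f := fun i => ‖F.translation i‖) (fun i _ => norm_nonneg _)
        (Finset.mem_univ _)

theorem canonicalProjection_eq_toMap (ω : ℕ → Fin m) :
    F.canonicalProjection ω = F.toMap (ω 0) (F.canonicalProjection (shiftWord 1 ω)) := by
  rw [canonicalProjection, (F.summable_canonicalProjection ω).tsum_eq_zero_add, toMap,
    canonicalProjection, ContinuousLinearMap.map_tsum _ (F.summable_canonicalProjection _), add_comm]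
  simp only [initialWord_succ', wordLinear_cons, mul_apply_eq_comp]
  rfl

theorem canonicalProjection_eq_wordMap (ω : ℕ → Fin m) (n : ℕ) :
    F.canonicalProjection ω =
      F.wordMap (initialWord ω n) (F.canonicalProjection (shiftWord n ω)) := by
  induction n with
  | zero => rfl
  | succ n ih =>
    rw [ih, initialWord_succ, wordMap_append, F.canonicalProjection_eq_toMap (shiftWord n ω),
      shiftWord_shiftWord]
    simp [shiftWord]

theorem canonicalProjection_prependWord (w : List (Fin m)) (ω : ℕ → Fin m) :
    F.canonicalProjection (prependWord w ω) = F.wordMap w (F.canonicalProjection ω) := by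
  rw [F.canonicalProjection_eq_wordMap _ w.length, initialWord_prependWord, shiftWord_prependWord]

theorem canonicalProjection_sub_of_initialWord_eq {ω ω' : ℕ → Fin m} {n : ℕ}
    (h : initialWord ω n = initialWord ω' n) :
    F.canonicalProjection ω - F.canonicalProjection ω' = F.wordLinear (initialWord ω n)
      (F.canonicalProjection (shiftWord n ω) - F.canonicalProjection (shiftWord n ω')) := by
  rw [F.canonicalProjection_eq_wordMap ω n, F.canonicalProjection_eq_wordMap ω' n, ← h, wordMap_sub]

theorem exists_dist_canonicalProjection_le : ∃ D : ℝ, 0 < D ∧ ∀ ω ω' : ℕ → Fin m,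
    ‖F.canonicalProjection ω - F.canonicalProjection ω'‖ ≤ D := by
  have hb := (isCompact_range F.continuous_canonicalProjection).isBounded
  obtain ⟨D, hD⟩ := Metric.isBounded_iff.1 hb
  refine ⟨max D 1, by positivity, fun ω ω' => ?_⟩
  rw [← dist_eq_norm]
  exact (hD (mem_range_self ω) (mem_range_self ω')).trans (le_max_left _ _)

/-- The points `f_{ω|ₙ}(yₙ)` tend to the projection of `ω` for every bounded sequence `yₙ`. -/
theorem tendsto_wordMap (ω : ℕ → Fin m) {y : ℕ → Plane} {M : ℝ}
    (hy : ∀ n, ‖y n‖ ≤ M) :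
    Tendsto (fun n => F.wordMap (initialWord ω n) (y n)) atTop
      (𝓝 (F.canonicalProjection ω)) := by
  obtain ⟨a, β, -, -, hβ0, hβ1, -, hβ⟩ := F.exists_ratio_bounds
  obtain ⟨D, hD0, hD⟩ := F.exists_dist_canonicalProjection_le
  rw [tendsto_iff_norm_sub_tendsto_zero]
  have hlim : Tendsto (fun n : ℕ => β ^ n * (M + (‖F.canonicalProjection ω‖ + D))) atTop (𝓝 0) := by
    simpa using (tendsto_pow_atTop_nhds_zero_of_lt_one hβ0.le hβ1).mul_const
      (M + (‖F.canonicalProjection ω‖ + D))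
  refine squeeze_zero (fun n => norm_nonneg _) (fun n => ?_) hlim
  rw [F.canonicalProjection_eq_wordMap ω n, wordMap_sub, ← F.canonicalProjection_eq_wordMap ω n]
  refine (ContinuousLinearMap.le_opNorm _ _).trans (mul_le_mul ?_ ?_ (norm_nonneg _) (by positivity))
  · simpa using F.norm_wordLinear_le_pow hβ0.le hβ (initialWord ω n)
  · refine (norm_sub_le _ _).trans (add_le_add (hy n) ?_)
    have h1 := hD (shiftWord n ω) ω
    have h2 := norm_sub_norm_le (F.canonicalProjection (shiftWord n ω)) (F.canonicalProjection ω)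
    linarith

variable {F} {E : Set Plane}

namespace IsSelfAffineSet

theorem toMap_mem (hE : F.IsSelfAffineSet E) (i : Fin m) {x : Plane} (hx : x ∈ E) :
    F.toMap i x ∈ E := by
  rw [hE.eq_iUnion]
  exact mem_iUnion.2 ⟨i, mem_image_of_mem _ hx⟩

theorem wordMap_mem (hE : F.IsSelfAffineSet E) (w : List (Fin m)) {x : Plane} (hx : x ∈ E) :
    F.wordMap w x ∈ E := by
  induction w with
  | nil => exact hx
  | cons i w ih => exact hE.toMap_mem i ih

theorem canonicalProjection_mem (hE : F.IsSelfAffineSet E) (ω : ℕ → Fin m) :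
    F.canonicalProjection ω ∈ E := by
  obtain ⟨e, he⟩ := hE.nonempty
  exact hE.isCompact.isClosed.mem_of_tendsto
    (F.tendsto_wordMap ω (y := fun _ => e) fun _ => le_rfl)
    (Eventually.of_forall fun n => hE.wordMap_mem _ he)

theorem range_canonicalProjection (hE : F.IsSelfAffineSet E) :
    range F.canonicalProjection = E := by
  refine (range_subset_iff.2 hE.canonicalProjection_mem).antisymm fun x hx => ?_
  have hstep : ∀ y : E, ∃ i : Fin m, ∃ z : E, F.toMap i z = y := by
    rintro ⟨y, hy⟩
    rw [hE.eq_iUnion] at hy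
    obtain ⟨i, z, hz, hzy⟩ := mem_iUnion.1 hy
    exact ⟨i, ⟨z, hz⟩, hzy⟩
  choose i z hz using hstep
  have hx' : ∀ n, x = F.wordMap (initialWord (fun k => i (z^[k] ⟨x, hx⟩)) n)
      (z^[n] ⟨x, hx⟩ : E) := by
    intro n
    induction n with
    | zero => rfl
    | succ n ih =>
      rw [initialWord_succ, wordMap_append]
      conv_lhs => rw [ih]
      simp only [Function.comp_apply, wordMap_cons, wordMap_nil, id, Function.iterate_succ_apply',
        hz]
  obtain ⟨M, hM⟩ := hE.isCompact.isBounded.exists_norm_le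
  refine ⟨fun k => i (z^[k] ⟨x, hx⟩), ?_⟩
  refine tendsto_nhds_unique (F.tendsto_wordMap _ (y := fun n => (z^[n] ⟨x, hx⟩ : E))
    fun n => hM _ (z^[n] ⟨x, hx⟩).2) ?_
  simp only [← hx']
  exact tendsto_const_nhds

end IsSelfAffineSet

/-- Under strong separation, a point of `E` within distance `δ α₂(ω|ₙ)` of `π(ω)` lies in the
cylinder of `ω|ₙ`. -/
theorem initialWord_eq_of_dist_le (hE : F.IsSelfAffineSet E) {δ : ℝ}
    (hδ : ∀ i j, i ≠ j → ∀ x ∈ F.toMap i '' E, ∀ y ∈ F.toMap j '' E, δ < dist x y)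
    (hδ0 : 0 < δ) {ω ω' : ℕ → Fin m} (n : ℕ)
    (h : ‖F.canonicalProjection ω - F.canonicalProjection ω'‖ ≤
      δ * F.singularValue 1 (initialWord ω n)) :
    initialWord ω n = initialWord ω' n := by
  obtain ⟨a, β, -, -, hβ0, hβ1, -, hβ⟩ := F.exists_ratio_bounds
  induction n with
  | zero => rfl
  | succ n ih =>
    have hmono : F.singularValue 1 (initialWord ω (n + 1)) ≤
        F.singularValue 1 (initialWord ω n) := by
      rw [initialWord_succ]
      refine (F.singularValue_one_append_le _ _).trans
        (mul_le_of_le_one_right (F.singularValue_nonneg _ _) ?_)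
      exact (F.singularValue_zero_le_pow hβ0.le hβ _).trans (pow_le_one₀ hβ0.le hβ1.le)
    have hle := h.trans (mul_le_mul_of_nonneg_left hmono hδ0.le)
    have hn := ih hle
    rw [initialWord_succ, initialWord_succ, hn]
    congr 2
    by_contra hne
    have hd := hδ _ _ hne (F.canonicalProjection (shiftWord n ω))
      ⟨_, hE.canonicalProjection_mem (shiftWord 1 (shiftWord n ω)), by
        rw [F.canonicalProjection_eq_toMap (shiftWord n ω)]; simp [shiftWord]⟩
      (F.canonicalProjection (shiftWord n ω'))
      ⟨_, hE.canonicalProjection_mem (shiftWord 1 (shiftWord n ω')), by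
        rw [F.canonicalProjection_eq_toMap (shiftWord n ω')]; simp [shiftWord]⟩
    rw [F.canonicalProjection_sub_of_initialWord_eq hn] at hle
    have h1 := (F.le_norm_wordLinear_apply _ _).trans hle
    rw [mul_comm δ, mul_le_mul_iff_right₀ (F.singularValue_pos _ _), ← dist_eq_norm] at h1
    exact absurd h1 (not_le.2 hd)

theorem canonicalProjection_injective (hE : F.IsSelfAffineSet E) (hsep : F.StrongSeparation E) :
    Function.Injective F.canonicalProjection := by
  obtain ⟨δ, hδ0, hδ⟩ := hsep
  intro ω ω' h
  have hn : ∀ n, initialWord ω n = initialWord ω' n := fun n => by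
    refine initialWord_eq_of_dist_le hE hδ hδ0 n ?_
    rw [h, sub_self, norm_zero]
    exact mul_nonneg hδ0.le (F.singularValue_nonneg _ _)
  funext n
  have := hn (n + 1)
  rw [initialWord_succ, initialWord_succ, hn n] at this
  simpa using this

end AffineIFS

namespace AffineIFS

variable {m : ℕ} (F : AffineIFS m)

/-! ### Principal directions and limiting directions -/

theorem exists_longAxis (w : List (Fin m)) : ∃ η : Plane, ‖η‖ = 1 ∧
    ContinuousLinearMap.adjoint (F.wordLinear w) (F.wordLinear w η) =
      (F.singularValue 0 w) ^ 2 • η := by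
  obtain ⟨e, he⟩ := exists_singular_frame (F.wordLinear w)
  exact ⟨e 0, e.norm_eq_one 0, he 0⟩

/-- A choice of the unit vector `η` that `A_w` stretches most: an eigenvector of `A_wᵀ A_w` with
eigenvalue `α₁(w)²`. -/
noncomputable def longAxis (w : List (Fin m)) : Plane := (F.exists_longAxis w).choose

/-- The choice `A_w η / α₁(w)` of the principal direction `ϑ₁(w)` given by `longAxis`. -/
noncomputable def principalDirection (w : List (Fin m)) : Plane :=
  (F.singularValue 0 w)⁻¹ • F.wordLinear w (F.longAxis w)

theorem norm_longAxis (w : List (Fin m)) : ‖F.longAxis w‖ = 1 :=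
  (F.exists_longAxis w).choose_spec.1

theorem adjoint_longAxis (w : List (Fin m)) :
    ContinuousLinearMap.adjoint (F.wordLinear w) (F.wordLinear w (F.longAxis w)) =
      (F.singularValue 0 w) ^ 2 • F.longAxis w :=
  (F.exists_longAxis w).choose_spec.2

theorem norm_wordLinear_longAxis (w : List (Fin m)) :
    ‖F.wordLinear w (F.longAxis w)‖ = F.singularValue 0 w :=
  norm_map_of_adjoint_eq _ (F.singularValue_nonneg 0 w) (F.norm_longAxis w) (F.adjoint_longAxis w)

theorem isPrincipalDirection_principalDirection (w : List (Fin m)) :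
    F.IsPrincipalDirection w (F.principalDirection w) :=
  ⟨_, F.norm_longAxis w, F.adjoint_longAxis w, by
    rw [norm_wordLinear_longAxis, principalDirection]⟩

theorem IsPrincipalDirection.neg {F : AffineIFS m} {w : List (Fin m)} {u : Plane}
    (h : F.IsPrincipalDirection w u) : F.IsPrincipalDirection w (-u) := by
  obtain ⟨η, h1, h2, h3⟩ := h
  refine ⟨-η, by rwa [norm_neg], by simp [h2], by simp [h3]⟩

theorem IsPrincipalDirection.norm_eq_one {F : AffineIFS m} {w : List (Fin m)} {u : Plane}
    (h : F.IsPrincipalDirection w u) : ‖u‖ = 1 := by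
  obtain ⟨η, h1, h2, rfl⟩ := h
  have := norm_map_of_adjoint_eq _ (F.singularValue_nonneg 0 w) h1 h2
  rw [norm_smul, norm_inv, norm_norm, inv_mul_cancel₀]
  rw [this]; exact (F.singularValue_pos _ _).ne'

theorem norm_principalDirection (w : List (Fin m)) : ‖F.principalDirection w‖ = 1 :=
  (F.isPrincipalDirection_principalDirection w).norm_eq_one

theorem abs_planeCross_principalDirection_le (w : List (Fin m)) (y : Plane) :
    |planeCross (F.principalDirection w) (F.wordLinear w y)| ≤ F.singularValue 1 w * ‖y‖ :=
  abs_planeCross_map_le _ (F.norm_longAxis w) (F.singularValue_pos 0 w) y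

theorem inner_principalDirection (w : List (Fin m)) (y : Plane) :
    (inner ℝ (F.principalDirection w) (F.wordLinear w y) : ℝ) =
      F.singularValue 0 w * inner ℝ (F.longAxis w) y := by
  have hpos := F.singularValue_pos 0 w
  rw [principalDirection, real_inner_smul_left,
    inner_map_singular_frame _ (F.adjoint_longAxis w)]
  field_simp

/-- If the singular values of `A_w` are different, then `ϑ₁(w)` is unique up to its sign. -/
theorem planeCross_principalDirection_eq_zero {w : List (Fin m)}
    (hw : F.singularValue 1 w < F.singularValue 0 w) {u : Plane}
    (hu : F.IsPrincipalDirection w u) : planeCross (F.principalDirection w) u = 0 := by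
  have hu1 := hu.norm_eq_one
  obtain ⟨η, h1, h2, h3⟩ := hu
  have h0 := F.singularValue_pos 0 w
  have hn := norm_map_of_adjoint_eq _ (F.singularValue_nonneg 0 w) h1 h2
  rw [hn] at h3
  have hin : (inner ℝ (F.principalDirection w) u : ℝ) = inner ℝ (F.longAxis w) η := by
    rw [h3, real_inner_smul_right, inner_principalDirection]
    field_simp
  have hcr : |planeCross (F.principalDirection w) u| * F.singularValue 0 w =
      F.singularValue 1 w * |planeCross (F.longAxis w) η| := by
    have hm := planeCross_map (F.wordLinear w : Plane →ₗ[ℝ] Plane) (F.longAxis w) η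
    simp only [ContinuousLinearMap.coe_coe] at hm
    rw [h3, principalDirection, planeCross_smul_left, planeCross_smul_right, hm, abs_mul, abs_mul,
      abs_mul, ← singularValue_mul, abs_inv, abs_of_pos h0]
    field_simp
  have e1 := inner_sq_add_planeCross_sq (F.principalDirection w) u
  have e2 := inner_sq_add_planeCross_sq (F.longAxis w) η
  rw [norm_principalDirection, hu1, hin] at e1
  rw [norm_longAxis, h1] at e2
  have habs : |planeCross (F.principalDirection w) u| = |planeCross (F.longAxis w) η| := by
    rw [← sq_eq_sq_iff_abs_eq_abs]; linarith
  rw [habs] at hcr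
  have : |planeCross (F.longAxis w) η| = 0 := by
    by_contra hne
    have := mul_right_cancel₀ hne (((mul_comm _ _).trans hcr))
    linarith
  rw [← abs_eq_zero, habs, this]

theorem abs_planeCross_principalDirection_append_le (w w' : List (Fin m)) :
    |planeCross (F.principalDirection w) (F.principalDirection (w ++ w'))| ≤
      F.singularValue 1 w / F.singularValue 0 w *
        (F.singularValue 0 w' / F.singularValue 1 w') := by
  have h0 := F.singularValue_pos 0 w
  have h1 := F.singularValue_pos 1 w
  have h0' := F.singularValue_pos 0 w'
  have h1' := F.singularValue_pos 1 w'
  have h := F.singularValue_pos 0 (w ++ w')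
  set y := F.wordLinear w' (F.longAxis (w ++ w')) with hy
  have hny : ‖y‖ ≤ F.singularValue 0 w' := by
    have := F.norm_wordLinear_apply_le w' (F.longAxis (w ++ w'))
    rwa [norm_longAxis, mul_one] at this
  have hu : F.principalDirection (w ++ w') = (F.singularValue 0 (w ++ w'))⁻¹ • F.wordLinear w y := by
    rw [principalDirection, wordLinear_append, mul_apply_eq_comp]
  rw [hu, planeCross_smul_right, abs_mul, abs_inv, abs_of_pos h, inv_mul_eq_div, div_le_iff₀ h]
  calc |planeCross (F.principalDirection w) (F.wordLinear w y)|
      ≤ F.singularValue 1 w * ‖y‖ := F.abs_planeCross_principalDirection_le w y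
    _ ≤ F.singularValue 1 w * F.singularValue 0 w' := by gcongr
    _ = F.singularValue 1 w / F.singularValue 0 w *
        (F.singularValue 0 w' / F.singularValue 1 w') *
          (F.singularValue 0 w * F.singularValue 1 w') := by field_simp
    _ ≤ _ := by gcongr; exact F.singularValue_zero_mul_le_append w w'

/-- The eccentricity `α₂(w) / α₁(w)`, which tends to `0` if the cylinders become thin. -/
noncomputable def eccentricity (w : List (Fin m)) : ℝ := F.singularValue 1 w / F.singularValue 0 w

theorem eccentricity_pos (w : List (Fin m)) : 0 < F.eccentricity w :=
  div_pos (F.singularValue_pos _ _) (F.singularValue_pos _ _)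

/-- Signs can be chosen such that consecutive principal directions form acute angles. These angles
are at most a constant times the eccentricities. -/
theorem exists_isLimitDirection {ω : ℕ → Fin m}
    (hs : Summable fun n => F.eccentricity (initialWord ω n)) :
    ∃ v, F.IsLimitDirection ω v := by
  classical
  obtain ⟨a, β, ha0, -, hβ0, hβ1, ha, hβ⟩ := F.exists_ratio_bounds
  let step : ℕ → Plane → Plane := fun n x =>
    if 0 ≤ (inner ℝ x (F.principalDirection (initialWord ω (n + 1))) : ℝ) then
      F.principalDirection (initialWord ω (n + 1))
    else -F.principalDirection (initialWord ω (n + 1))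
  let v : ℕ → Plane := fun n =>
    Nat.rec (F.principalDirection (initialWord ω 0)) (fun n x => step n x) n
  have hv : ∀ n, v n = F.principalDirection (initialWord ω n) ∨
      v n = -F.principalDirection (initialWord ω n) := by
    intro n
    cases n with
    | zero => exact Or.inl rfl
    | succ n => exact ite_eq_or_eq _ _ _
  have hpr : ∀ n, F.IsPrincipalDirection (initialWord ω n) (v n) := by
    intro n
    rcases hv n with h | h <;> rw [h]
    · exact F.isPrincipalDirection_principalDirection _
    · exact (F.isPrincipalDirection_principalDirection _).neg
  have hin : ∀ n, 0 ≤ (inner ℝ (v n) (v (n + 1)) : ℝ) := by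
    intro n
    change 0 ≤ (inner ℝ (v n) (step n (v n)) : ℝ)
    by_cases h : 0 ≤ (inner ℝ (v n) (F.principalDirection (initialWord ω (n + 1))) : ℝ)
    · simp only [step, if_pos h]; exact h
    · simp only [step, if_neg h, inner_neg_right]; linarith
  have hcr : ∀ n, |planeCross (v n) (v (n + 1))| =
      |planeCross (F.principalDirection (initialWord ω n))
        (F.principalDirection (initialWord ω (n + 1)))| := by
    intro n
    have hneg : ∀ x : Plane, -x = (-1 : ℝ) • x := fun x => by simp
    rcases hv n with h | h <;> rcases hv (n + 1) with h' | h' <;> rw [h, h'] <;>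
      simp only [hneg, planeCross_smul_left, planeCross_smul_right] <;> simp
  clear_value v
  have hsum : Summable fun n => dist (v n) (v (n + 1)) := by
    refine Summable.of_nonneg_of_le (fun n => dist_nonneg) (fun n => ?_) (hs.mul_right (2 * (1 / a)))
    rw [dist_eq_norm]
    refine (norm_sub_le_of_inner_nonneg (hpr n).norm_eq_one (hpr (n + 1)).norm_eq_one (hin n)).trans ?_
    rw [hcr, initialWord_succ]
    have h1 := F.abs_planeCross_principalDirection_append_le (initialWord ω n) [ω n]
    have h2 : F.singularValue 0 [ω n] / F.singularValue 1 [ω n] ≤ 1 / a := by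
      have h3 : F.singularValue 0 [ω n] ≤ 1 :=
        (F.singularValue_zero_le_pow hβ0.le hβ _).trans (pow_le_one₀ hβ0.le hβ1.le)
      exact div_le_div₀ zero_le_one h3 ha0 (ha _)
    have h4 : |planeCross (F.principalDirection (initialWord ω n))
        (F.principalDirection (initialWord ω n ++ [ω n]))| ≤ F.eccentricity (initialWord ω n) * (1 / a) :=
      h1.trans (mul_le_mul_of_nonneg_left h2 (F.eccentricity_pos _).le)
    linarith
  obtain ⟨x, hx⟩ := cauchySeq_tendsto_of_complete (cauchySeq_of_summable_dist hsum)
  exact ⟨x, v, hpr, hx⟩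

variable {F} in
theorem IsLimitDirection.norm_eq_one {ω : ℕ → Fin m} {v : Plane} (h : F.IsLimitDirection ω v) :
    ‖v‖ = 1 := by
  obtain ⟨u, hu, hlim⟩ := h
  refine tendsto_nhds_unique hlim.norm ?_
  simp only [fun n => (hu n).norm_eq_one]
  exact tendsto_const_nhds

variable {F} in
theorem IsLimitDirection.tendsto_planeCross {ω : ℕ → Fin m} {v : Plane}
    (h : F.IsLimitDirection ω v)
    (hε : Tendsto (fun n => F.eccentricity (initialWord ω n)) atTop (𝓝 0)) :
    Tendsto (fun n => planeCross (F.principalDirection (initialWord ω n)) v) atTop (𝓝 0) := by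
  obtain ⟨u, hu, hlim⟩ := h
  have h1 := tendsto_iff_norm_sub_tendsto_zero.1 hlim
  refine squeeze_zero_norm' ?_ h1
  filter_upwards [hε.eventually_lt_const one_pos] with n hn
  rw [eccentricity, div_lt_one (F.singularValue_pos _ _)] at hn
  have h0 := F.planeCross_principalDirection_eq_zero hn (hu n)
  have : planeCross (F.principalDirection (initialWord ω n)) v =
      planeCross (F.principalDirection (initialWord ω n)) (v - u n) := by
    rw [planeCross_sub_right, h0, sub_zero]
  rw [this, Real.norm_eq_abs]
  refine (abs_planeCross_le _ _).trans ?_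
  rw [norm_principalDirection, one_mul, norm_sub_rev]

end AffineIFS

namespace AffineIFS

variable {m : ℕ}

/-! ### Self-similarity of the Bernoulli measure -/

theorem measurable_consWord (i : Fin m) : Measurable (consWord i) := by
  refine measurable_pi_iff.2 fun k => ?_
  cases k with
  | zero => exact measurable_const
  | succ k => exact measurable_pi_apply k

theorem consWord_injective (i : Fin m) : Function.Injective (consWord i) := by
  intro ω ω' h
  funext k
  exact congrFun h (k + 1)

theorem measurableEmbedding_consWord (i : Fin m) : MeasurableEmbedding (consWord i) :=
  (measurable_consWord i).measurableEmbedding (consWord_injective i)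

instance (p : PMF (Fin m)) : IsProbabilityMeasure (bernoulliMeasure p) := by
  unfold bernoulliMeasure; infer_instance

/-- The Bernoulli measure is the mixture of its images under the maps `ω ↦ i ω`. -/
theorem sum_map_consWord (p : PMF (Fin m)) :
    ∑ i, p i • (bernoulliMeasure p).map (consWord i) = bernoulliMeasure p := by
  refine Measure.eq_infinitePi _ fun s t ht => ?_
  -- Enlarge the finite index set to an initial segment of `ℕ`.
  obtain ⟨N, hN⟩ : ∃ N : ℕ, s ⊆ Finset.range (N + 1) := by
    obtain ⟨N, hN⟩ := s.exists_nat_subset_range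
    exact ⟨N, hN.trans (Finset.range_subset_range.2 (Nat.le_succ N))⟩
  let t' : ℕ → Set (Fin m) := fun k => if k ∈ s then t k else univ
  have hst : Set.pi s t = Set.pi (Finset.range (N + 1)) t' := by
    ext ω
    simp only [Set.mem_pi, Finset.mem_coe, t']
    refine ⟨fun h k _ => ?_, fun h k hk => ?_⟩
    · split_ifs with hk
      · exact h k hk
      · trivial
    · simpa [hk] using h k (hN hk)
  have hprod : ∏ k ∈ s, p.toMeasure (t k) = ∏ k ∈ Finset.range (N + 1), p.toMeasure (t' k) := by
    rw [← Finset.prod_subset hN]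
    · exact Finset.prod_congr rfl fun k hk => by simp [t', hk]
    · intro k _ hk
      simp [t', hk]
  have hpre : ∀ i, consWord i ⁻¹' Set.pi (Finset.range (N + 1)) t' =
      {ω | i ∈ t' 0} ∩ Set.pi (Finset.range N) fun k => t' (k + 1) := by
    intro i
    ext ω
    simp only [Set.mem_preimage, Set.mem_pi, Finset.mem_coe, Finset.mem_range, mem_inter_iff,
      mem_ofPred_eq]
    refine ⟨fun h => ⟨h 0 (by omega), fun k hk => h (k + 1) (by omega)⟩, fun h k hk => ?_⟩
    cases k with
    | zero => exact h.1
    | succ k => exact h.2 k (by omega)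
  rw [hst, hprod, Finset.prod_range_succ', Measure.finsetSum_apply]
  have hm : MeasurableSet (Set.pi (Finset.range (N + 1)) t') :=
    MeasurableSet.pi (Finset.countable_toSet _) fun k _ => MeasurableSet.of_discrete
  have hterm : ∀ i, (p i • (bernoulliMeasure p).map (consWord i))
      (Set.pi (Finset.range (N + 1)) t') =
      (t' 0).indicator p i * ∏ k ∈ Finset.range N, p.toMeasure (t' (k + 1)) := by
    intro i
    rw [Measure.smul_apply, Measure.map_apply (measurable_consWord i) hm, hpre i]
    by_cases hi : i ∈ t' 0
    · simp only [hi, ofPred_true, univ_inter, indicator_of_mem, smul_eq_mul]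
      congr 1
      exact Measure.infinitePi_pi _ fun k _ => MeasurableSet.of_discrete
    · simp [hi]
  simp only [hterm]
  rw [← Finset.sum_mul, mul_comm, PMF.toMeasure_apply_fintype]

theorem sum_toReal_eq_one (p : PMF (Fin m)) : ∑ i, (p i).toReal = 1 := by
  rw [← ENNReal.toReal_sum fun i _ => p.apply_ne_top i]
  have := p.tsum_coe
  rw [tsum_fintype] at this
  rw [this, ENNReal.toReal_one]

theorem bernoulliMeasure_real_eq_sum (p : PMF (Fin m)) (S : Set (ℕ → Fin m)) :
    (bernoulliMeasure p).real S =
      ∑ i, (p i).toReal * (bernoulliMeasure p).real (consWord i ⁻¹' S) := by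
  conv_lhs => rw [← sum_map_consWord p]
  rw [measureReal_def, Measure.finsetSum_apply, ENNReal.toReal_sum]
  · refine Finset.sum_congr rfl fun i _ => ?_
    rw [Measure.smul_apply, (measurableEmbedding_consWord i).map_apply, smul_eq_mul,
      ENNReal.toReal_mul, measureReal_def]
  · intro i _
    rw [Measure.smul_apply, (measurableEmbedding_consWord i).map_apply, smul_eq_mul]
    exact ENNReal.mul_ne_top (p.apply_ne_top i) (measure_ne_top _ _)

theorem bernoulliMeasure_real_le_of_forall (p : PMF (Fin m)) {b : ℝ} (n : ℕ)
    (S : Set (ℕ → Fin m))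
    (h : ∀ w : List (Fin m), w.length = n →
      (bernoulliMeasure p).real (prependWord w ⁻¹' S) ≤ b) :
    (bernoulliMeasure p).real S ≤ b := by
  induction n generalizing S with
  | zero => exact h [] rfl
  | succ n ih =>
    rw [bernoulliMeasure_real_eq_sum]
    calc _ ≤ ∑ i, (p i).toReal * b := by
          refine Finset.sum_le_sum fun i _ => mul_le_mul_of_nonneg_left ?_ ENNReal.toReal_nonneg
          exact ih _ fun w hw => h (i :: w) (by simp [hw])
      _ = b := by rw [← Finset.sum_mul, sum_toReal_eq_one, one_mul]

/-- An event that is impossible after one particular initial word has smaller probability than the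
largest of its conditional probabilities given the initial word, by a definite factor. -/
theorem bernoulliMeasure_real_le_of_hole (p : PMF (Fin m)) {b q : ℝ} (hb : 0 ≤ b) (hq0 : 0 ≤ q)
    (hq : ∀ i, q ≤ (p i).toReal) (S : Set (ℕ → Fin m)) (w₀ : List (Fin m))
    (h : ∀ w : List (Fin m), w.length = w₀.length →
      (bernoulliMeasure p).real (prependWord w ⁻¹' S) ≤ b)
    (h0 : prependWord w₀ ⁻¹' S = ∅) :
    (bernoulliMeasure p).real S ≤ (1 - q ^ w₀.length) * b := by
  induction w₀ generalizing S with
  | nil =>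
    have : S = ∅ := h0
    simp [this]
  | cons j w₀ ih =>
    have hj := ih (consWord j ⁻¹' S) (fun w hw => h (j :: w) (by simp [hw])) h0
    have hi : ∀ i, (bernoulliMeasure p).real (consWord i ⁻¹' S) ≤ b := fun i =>
      bernoulliMeasure_real_le_of_forall p w₀.length _ fun w hw => h (i :: w) (by simp [hw])
    rw [bernoulliMeasure_real_eq_sum, ← Finset.add_sum_erase _ _ (Finset.mem_univ j)]
    have hsum := sum_toReal_eq_one p
    rw [← Finset.add_sum_erase _ _ (Finset.mem_univ j)] at hsum
    have h1 : ∑ i ∈ Finset.univ.erase j,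
        (p i).toReal * (bernoulliMeasure p).real (consWord i ⁻¹' S) ≤
        (∑ i ∈ Finset.univ.erase j, (p i).toReal) * b := by
      rw [Finset.sum_mul]
      exact Finset.sum_le_sum fun i _ => mul_le_mul_of_nonneg_left (hi i) ENNReal.toReal_nonneg
    have h2 := mul_le_mul_of_nonneg_left hj (ENNReal.toReal_nonneg (a := p j))
    have h3 : q * (q ^ w₀.length * b) ≤ (p j).toReal * (q ^ w₀.length * b) :=
      mul_le_mul_of_nonneg_right (hq j) (by positivity)
    have h4 : ∑ i ∈ Finset.univ.erase j, (p i).toReal = 1 - (p j).toReal := by linarith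
    rw [h4] at h1
    rw [List.length_cons, pow_succ']
    nlinarith

/-! ### Decay of the measure of strips -/

variable (F : AffineIFS m)

/-- The infinite words whose projection to the plane lies in the closed strip
`|⟪η, x⟫ - c| ≤ ρ`. -/
def stripWords (η : Plane) (c ρ : ℝ) : Set (ℕ → Fin m) :=
  {ω | |(inner ℝ η (F.canonicalProjection ω) : ℝ) - c| ≤ ρ}

theorem le_norm_adjoint_wordLinear (w : List (Fin m)) {η : Plane} (hη : ‖η‖ = 1) :
    F.singularValue 1 w ≤ ‖ContinuousLinearMap.adjoint (F.wordLinear w) η‖ := by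
  obtain ⟨y, hy⟩ := F.wordLinear_surjective w η
  have h1 := F.le_norm_wordLinear_apply w y
  rw [hy, hη] at h1
  have h2 : (1 : ℝ) ≤ ‖ContinuousLinearMap.adjoint (F.wordLinear w) η‖ * ‖y‖ := by
    refine le_trans (le_of_eq ?_) (real_inner_le_norm _ _)
    rw [ContinuousLinearMap.adjoint_inner_left, hy, real_inner_self_eq_norm_sq, hη, one_pow]
  have h3 : 0 < ‖y‖ := by
    rw [norm_pos_iff]; rintro rfl; simp at h2; linarith
  exact le_of_mul_le_mul_right (h1.trans h2) h3

/-- Pulling a strip back by `f_w` gives a strip, which is wider by a factor at most `1 / α₂(w)`. -/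
theorem exists_preimage_stripWords_subset (w : List (Fin m)) {η : Plane} (hη : ‖η‖ = 1) (c : ℝ)
    {ρ ρ' : ℝ} (hρ : ρ ≤ F.singularValue 1 w * ρ') (hρ' : 0 ≤ ρ') :
    ∃ (η' : Plane) (c' : ℝ), ‖η'‖ = 1 ∧
      prependWord w ⁻¹' F.stripWords η c ρ ⊆ F.stripWords η' c' ρ' := by
  set z := ContinuousLinearMap.adjoint (F.wordLinear w) η with hz
  have hle := F.le_norm_adjoint_wordLinear w hη
  have hN : 0 < ‖z‖ := (F.singularValue_pos 1 w).trans_le hle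
  refine ⟨‖z‖⁻¹ • z, ‖z‖⁻¹ * (c - inner ℝ η (F.wordMap w 0)), ?_, fun ω hω => ?_⟩
  · rw [norm_smul, norm_inv, norm_norm, inv_mul_cancel₀ hN.ne']
  · have hω' : |(inner ℝ η (F.canonicalProjection (prependWord w ω)) : ℝ) - c| ≤ ρ := hω
    change |(inner ℝ (‖z‖⁻¹ • z) (F.canonicalProjection ω) : ℝ) - _| ≤ _
    have hm := F.wordMap_sub w (F.canonicalProjection ω) 0
    rw [sub_zero, sub_eq_iff_eq_add] at hm
    rw [canonicalProjection_prependWord, hm, inner_add_right] at hω'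
    rw [real_inner_smul_left, hz, ContinuousLinearMap.adjoint_inner_left, ← hz, ← mul_sub, abs_mul,
      abs_inv, abs_norm, inv_mul_le_iff₀ hN, ← sub_add]
    rw [add_sub_right_comm] at hω'
    exact hω'.trans (hρ.trans (mul_le_mul_of_nonneg_right hle hρ'))

/-- If `E` has positive width in all directions, then the measures of strips decay like a power of
their widths. A narrow strip misses some cylinder of a fixed level, so that passing to smaller
scales loses a definite proportion of the mass. -/
theorem exists_measure_stripWords_le (p : PMF (Fin m)) (hp : ∀ i, 0 < p i) {ℓ : ℝ} (hℓ : 0 < ℓ)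
    (hwidth : ∀ η : Plane, ‖η‖ = 1 → ∃ ω ω' : ℕ → Fin m,
      ℓ ≤ inner ℝ η (F.canonicalProjection ω - F.canonicalProjection ω')) :
    ∃ C s : ℝ, 0 < C ∧ 0 < s ∧ ∀ (η : Plane) (c ρ : ℝ), ‖η‖ = 1 → 0 < ρ →
      (bernoulliMeasure p).real (F.stripWords η c ρ) ≤ C * ρ ^ s := by
  obtain ⟨a, β, ha0, ha1, hβ0, hβ1, ha, hβ⟩ := F.exists_ratio_bounds
  obtain ⟨D, hD0, hD⟩ := F.exists_dist_canonicalProjection_le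
  obtain ⟨n, hn⟩ : ∃ n : ℕ, β ^ n < ℓ / (4 * D) := exists_pow_lt_of_lt_one (by positivity) hβ1
  rw [lt_div_iff₀ (by positivity)] at hn
  obtain ⟨q, hq0, hq1, hq⟩ : ∃ q : ℝ, 0 < q ∧ q < 1 ∧ ∀ i, q ≤ (p i).toReal := by
    have h1 : ∀ᶠ q in 𝓝[>] (0 : ℝ), (0 < q ∧ q < 1) ∧ ∀ i, q ≤ (p i).toReal := by
      refine Eventually.and (Ioo_mem_nhdsGT one_pos) (eventually_all.2 fun i => ?_)
      filter_upwards [Ioo_mem_nhdsGT (ENNReal.toReal_pos (hp i).ne' (p.apply_ne_top i))] with q hq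
        using hq.2.le
    obtain ⟨q, ⟨h1, h2⟩, h3⟩ := h1.exists
    exact ⟨q, h1, h2, h3⟩
  -- `n = 0` would make the factor `1 - q ^ n` vanish and leave no exponent
  have hn0 : n ≠ 0 := by
    rintro rfl
    obtain ⟨η, hη⟩ : ∃ η : Plane, ‖η‖ = 1 := ⟨_, F.norm_longAxis []⟩
    obtain ⟨ω, ω', h⟩ := hwidth η hη
    have := (h.trans (real_inner_le_norm _ _)).trans
      (mul_le_mul_of_nonneg_left (hD ω ω') (norm_nonneg _))
    rw [hη] at this
    linarith
  set θ : ℝ := 1 - q ^ n with hθ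
  have hθ0 : 0 < θ := by
    have := pow_lt_one₀ hq0.le hq1 hn0
    linarith
  have hθ1 : θ < 1 := by
    have : 0 < q ^ n := by positivity
    linarith
  set κ : ℝ := a ^ n with hκ
  have hκ0 : 0 < κ := by positivity
  have hκ1 : κ < 1 := pow_lt_one₀ ha0.le ha1 hn0
  have hlevel : ∀ k : ℕ, ∀ (η : Plane) (c : ℝ), ‖η‖ = 1 →
      (bernoulliMeasure p).real (F.stripWords η c (ℓ / 8 * κ ^ k)) ≤ θ ^ k := by
    intro k
    induction k with
    | zero => intro η c _; simp
    | succ k ih =>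
      intro η c hη
      have hsmall : ℓ / 8 * κ ^ (k + 1) ≤ ℓ / 8 :=
        mul_le_of_le_one_right (by positivity) (pow_le_one₀ hκ0.le hκ1.le)
      obtain ⟨ξ, hξ⟩ : ∃ ξ, 3 * ℓ / 8 < |(inner ℝ η (F.canonicalProjection ξ) : ℝ) - c| := by
        obtain ⟨ω, ω', h⟩ := hwidth η hη
        by_contra! hcon
        have h1 := abs_le.1 (hcon ω)
        have h2 := abs_le.1 (hcon ω')
        rw [inner_sub_right] at h
        linarith [h1.1, h1.2, h2.1, h2.2]
      have := bernoulliMeasure_real_le_of_hole p (b := θ ^ k) (by positivity) hq0.le hq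
        (F.stripWords η c (ℓ / 8 * κ ^ (k + 1))) (initialWord ξ n) ?_ ?_
      · rwa [length_initialWord, ← hθ, ← pow_succ'] at this
      · intro w hw
        rw [length_initialWord] at hw
        obtain ⟨η', c', hη', hsub⟩ := F.exists_preimage_stripWords_subset w hη c
          (ρ := ℓ / 8 * κ ^ (k + 1)) (ρ' := ℓ / 8 * κ ^ k) (by
            have := F.pow_le_singularValue_one ha0.le ha w
            rw [hw, ← hκ] at this
            calc ℓ / 8 * κ ^ (k + 1) = κ * (ℓ / 8 * κ ^ k) := by ring
              _ ≤ _ := by gcongr) (by positivity)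
        exact (measureReal_mono hsub).trans (ih η' c' hη')
      · refine eq_empty_iff_forall_notMem.2 fun ω hω => ?_
        have hω' : |(inner ℝ η (F.canonicalProjection (prependWord (initialWord ξ n) ω)) : ℝ) - c|
          ≤ ℓ / 8 * κ ^ (k + 1) := hω
        have hd : |(inner ℝ η (F.canonicalProjection ξ -
            F.canonicalProjection (prependWord (initialWord ξ n) ω)) : ℝ)| ≤ ℓ / 4 := by
          refine (abs_real_inner_le_norm _ _).trans ?_
          rw [hη, one_mul, F.canonicalProjection_sub_of_initialWord_eq (n := n) (by
            have h := initialWord_prependWord (initialWord ξ n) ω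
            rw [length_initialWord] at h
            exact h.symm)]
          have h1 := (F.norm_wordLinear_apply_le (initialWord ξ n) _).trans
            (mul_le_mul (F.singularValue_zero_le_pow hβ0.le hβ (initialWord ξ n))
              (hD (shiftWord n ξ) (shiftWord n (prependWord (initialWord ξ n) ω)))
              (norm_nonneg _) (by positivity))
          rw [length_initialWord] at h1
          linarith
        rw [inner_sub_right] at hd
        have h3 := abs_sub_le (inner ℝ η (F.canonicalProjection ξ) : ℝ)
          (inner ℝ η (F.canonicalProjection (prependWord (initialWord ξ n) ω))) c
        linarith
  -- the exponent is chosen such that `κ ^ s = θ`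
  set s : ℝ := Real.log θ / Real.log κ with hs
  have hlκ : Real.log κ < 0 := Real.log_neg hκ0 hκ1
  have hlθ : Real.log θ < 0 := Real.log_neg hθ0 hθ1
  have hs0 : 0 < s := div_pos_of_neg_of_neg hlθ hlκ
  have hκs : κ ^ s = θ := by
    rw [Real.rpow_def_of_pos hκ0, hs, mul_div_cancel₀ _ hlκ.ne, Real.exp_log hθ0]
  refine ⟨θ⁻¹ * (ℓ / 8)⁻¹ ^ s, s, by positivity, hs0, fun η c ρ hη hρ => ?_⟩
  rw [mul_assoc, ← Real.mul_rpow (by positivity) hρ.le]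
  rcases le_or_gt 1 ((ℓ / 8)⁻¹ * ρ) with h1 | h1
  · refine measureReal_le_one.trans ?_
    have := Real.one_le_rpow h1 hs0.le
    have h2 : 1 ≤ θ⁻¹ := (one_le_inv₀ hθ0).2 hθ1.le
    nlinarith
  · obtain ⟨k, hk1, hk2⟩ := exists_nat_pow_near_of_lt_one (x := (ℓ / 8)⁻¹ * ρ) (by positivity) h1.le
      hκ0 hκ1
    have hρk : ρ ≤ ℓ / 8 * κ ^ k := by
      rwa [inv_mul_le_iff₀ (by positivity)] at hk2
    have hsub : F.stripWords η c ρ ⊆ F.stripWords η c (ℓ / 8 * κ ^ k) :=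
      fun ω hω => le_trans hω hρk
    refine (measureReal_mono hsub).trans ((hlevel k η c hη).trans ?_)
    rw [le_inv_mul_iff₀ hθ0, ← pow_succ']
    calc θ ^ (k + 1) = (κ ^ (k + 1)) ^ s := by
          rw [← hκs, ← Real.rpow_natCast, ← Real.rpow_natCast, ← Real.rpow_mul hκ0.le,
            ← Real.rpow_mul hκ0.le, mul_comm]
      _ ≤ _ := Real.rpow_le_rpow (by positivity) hk1.le hs0.le

end AffineIFS

namespace AffineIFS

variable {m : ℕ} {F : AffineIFS m} {E : Set Plane}

/-! ### Projections of cylinders -/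

theorem cylinder_eq_range (hE : F.IsSelfAffineSet E) (w : List (Fin m)) :
    F.cylinder E w = range fun ξ => F.canonicalProjection (prependWord w ξ) := by
  simp only [canonicalProjection_prependWord]
  rw [cylinder, ← hE.range_canonicalProjection, ← range_comp]
  rfl

theorem isPreconnected_range_inner (hE : F.IsSelfAffineSet E) {v : Plane} {w : List (Fin m)}
    (h : IsLineSegment (projOnto v (F.cylinder E w))) :
    IsPreconnected
      (range fun ξ => (inner ℝ v (F.canonicalProjection (prependWord w ξ)) : ℝ)) := by
  obtain ⟨a, b, -, hab⟩ := h
  have h1 : IsPreconnected (projOnto v (F.cylinder E w)) := by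
    rw [hab]; exact (convex_segment a b).isPreconnected
  have h2 := h1.image (fun z : Plane => (inner ℝ v z : ℝ)) (by fun_prop)
  rw [projOnto, cylinder_eq_range hE, ← range_comp, ← range_comp] at h2
  convert h2 using 2
  funext ξ
  simp only [Function.comp_apply]
  rw [← Submodule.inner_starProjection_left_eq_right,
    Submodule.starProjection_eq_self_iff.2 (Submodule.mem_span_singleton_self v)]

theorem exists_inner_ne_of_isLineSegment {v : Plane} {w : List (Fin m)}
    (hE : F.IsSelfAffineSet E) (h : IsLineSegment (projOnto v (F.cylinder E w))) :
    ∃ ξ ξ', (inner ℝ v (F.canonicalProjection (prependWord w ξ)) : ℝ) ≠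
      inner ℝ v (F.canonicalProjection (prependWord w ξ')) := by
  obtain ⟨a, b, hne, hab⟩ := h
  have ha : a ∈ projOnto v (F.cylinder E w) := hab ▸ left_mem_segment ℝ a b
  have hb : b ∈ projOnto v (F.cylinder E w) := hab ▸ right_mem_segment ℝ a b
  rw [projOnto, cylinder_eq_range hE, ← range_comp] at ha hb
  obtain ⟨ξ, rfl⟩ := ha
  obtain ⟨ξ', rfl⟩ := hb
  refine ⟨ξ, ξ', fun heq => hne ?_⟩
  simp only [Function.comp_apply, Submodule.starProjection_singleton, heq]

/-- A strongly separated self-affine set one of whose cylinders projects onto a non-degenerate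
segment is not contained in a line: on a line, the projection would be injective, but the set is
disconnected. -/
theorem exists_planeCross_ne_zero (hm : 2 ≤ m) (hE : F.IsSelfAffineSet E)
    (hsep : F.StrongSeparation E) {v : Plane} {w : List (Fin m)}
    (h : IsLineSegment (projOnto v (F.cylinder E w))) :
    ∃ ω ω' ξ : ℕ → Fin m, planeCross (F.canonicalProjection ω - F.canonicalProjection ξ)
      (F.canonicalProjection ω' - F.canonicalProjection ξ) ≠ 0 := by
  by_contra! hcon
  have hconn := isPreconnected_range_inner hE h
  obtain ⟨ξ₁, ξ₂, hne⟩ := exists_inner_ne_of_isLineSegment hE h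
  set g : (ℕ → Fin m) → ℝ := fun ξ => inner ℝ v (F.canonicalProjection (prependWord w ξ)) with hg
  have hgsub : ∀ ξ ξ', g ξ - g ξ' =
      inner ℝ v (F.wordLinear w (F.canonicalProjection ξ - F.canonicalProjection ξ')) := by
    intro ξ ξ'
    rw [← wordMap_sub, inner_sub_right, ← canonicalProjection_prependWord,
      ← canonicalProjection_prependWord]
  have hgc : Continuous g := by
    have : g = fun ξ => (inner ℝ v (F.wordMap w (F.canonicalProjection ξ)) : ℝ) := by
      funext ξ; rw [hg]; simp only [canonicalProjection_prependWord]
    rw [this]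
    exact continuous_const.inner ((F.continuous_wordMap w).comp F.continuous_canonicalProjection)
  have hginj : Function.Injective g := by
    intro ω ξ hωξ
    by_contra hωne
    have hne' : F.canonicalProjection ω - F.canonicalProjection ξ ≠ 0 :=
      sub_ne_zero.2 fun h => hωne (canonicalProjection_injective hE hsep h)
    have h0 := hgsub ω ξ
    rw [hωξ, sub_self] at h0
    have hconst : ∀ ω', g ω' = g ξ := by
      intro ω'
      set x := F.canonicalProjection ω - F.canonicalProjection ξ with hx
      set y := F.canonicalProjection ω' - F.canonicalProjection ξ with hy
      have hxy : planeCross x y = 0 := hcon ω ω' ξ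
      have hn := plane_norm_sq x
      have hpos : 0 < ‖x‖ ^ 2 := by positivity
      have hyx : y = ((inner ℝ x y : ℝ) / ‖x‖ ^ 2) • x := by
        rw [planeCross] at hxy
        have h2 : ‖x‖ ^ 2 • y = (inner ℝ x y : ℝ) • x := by
          rw [hn, plane_inner_eq]
          ext k
          fin_cases k
          · simp only [PiLp.smul_apply, smul_eq_mul, Fin.zero_eta]
            linear_combination -x 1 * hxy
          · simp only [PiLp.smul_apply, smul_eq_mul, Fin.mk_one]
            linear_combination x 0 * hxy
        rw [div_eq_inv_mul, mul_smul, ← h2, smul_smul, inv_mul_cancel₀ hpos.ne', one_smul]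
      rw [← sub_eq_zero, hgsub, ← hy, hyx, map_smul, inner_smul_right, ← h0, mul_zero]
    exact hne ((hconst ξ₁).trans (hconst ξ₂).symm)
  -- the words beginning with `0`, and the other ones
  have i0 : Fin m := ⟨0, by omega⟩
  let i1 : Fin m := if i0 = ⟨0, by omega⟩ then ⟨1, by omega⟩ else ⟨0, by omega⟩
  have hi : i1 ≠ i0 := by
    simp only [i1]
    split_ifs with h
    · rw [h]; simp
    · exact fun h' => h h'.symm
  let U : Set (ℕ → Fin m) := {ω | ω 0 = i0}
  have hU : IsClopen U := (isClopen_discrete {i0}).preimage (continuous_apply 0)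
  have hcU := (hU.1.isCompact.image hgc).isClosed
  have hcV := (hU.compl.1.isCompact.image hgc).isClosed
  obtain ⟨x, -, ⟨ω, hω, rfl⟩, ⟨ω', hω', hx⟩⟩ := isPreconnected_closed_iff.1 hconn _ _ hcU hcV
    (by rw [← image_union, union_compl_self, image_univ])
    ⟨g fun _ => i0, mem_range_self _, mem_image_of_mem _ rfl⟩
    ⟨g fun _ => i1, mem_range_self _, mem_image_of_mem _ hi⟩
  exact hω' (hginj hx ▸ hω)

/-- A self-affine set that is not contained in a line has positive width in all directions. -/
theorem exists_width (h : ∃ ω ω' ξ : ℕ → Fin m,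
      planeCross (F.canonicalProjection ω - F.canonicalProjection ξ)
      (F.canonicalProjection ω' - F.canonicalProjection ξ) ≠ 0) :
    ∃ ℓ : ℝ, 0 < ℓ ∧ ∀ η : Plane, ‖η‖ = 1 → ∃ ω ω' : ℕ → Fin m,
      ℓ ≤ inner ℝ η (F.canonicalProjection ω - F.canonicalProjection ω') := by
  obtain ⟨ω, ω', ξ, hne⟩ := h
  set x := F.canonicalProjection ω - F.canonicalProjection ξ with hx
  set y := F.canonicalProjection ω' - F.canonicalProjection ξ with hy
  have hd : 0 < |planeCross x y| := abs_pos.2 hne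
  have hsum : 0 < ‖x‖ + ‖y‖ := by
    by_contra! hle
    have h1 := abs_planeCross_le x y
    have hx0 : ‖x‖ = 0 := by linarith [norm_nonneg x, norm_nonneg y]
    rw [hx0, zero_mul] at h1
    linarith
  refine ⟨|planeCross x y| / (‖x‖ + ‖y‖), by positivity, fun η hη => ?_⟩
  have hsym : ∀ ω₁ ω₂ : ℕ → Fin m, |planeCross x y| / (‖x‖ + ‖y‖) ≤
      |(inner ℝ η (F.canonicalProjection ω₁ - F.canonicalProjection ω₂) : ℝ)| →
      ∃ ω ω' : ℕ → Fin m, |planeCross x y| / (‖x‖ + ‖y‖) ≤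
        inner ℝ η (F.canonicalProjection ω - F.canonicalProjection ω') := by
    intro ω₁ ω₂ h12
    rcases le_abs'.1 h12 with h | h
    · refine ⟨ω₂, ω₁, ?_⟩
      rw [← neg_sub, inner_neg_right]; linarith
    · exact ⟨ω₁, ω₂, h⟩
  have key : |planeCross x y| ≤ |(inner ℝ η x : ℝ)| * ‖y‖ + |(inner ℝ η y : ℝ)| * ‖x‖ := by
    rw [planeCross_eq_of_norm_eq_one hη]
    refine (abs_sub _ _).trans ?_
    rw [abs_mul, abs_mul]
    have h1 := abs_planeCross_le η x
    have h2 := abs_planeCross_le η y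
    rw [hη, one_mul] at h1 h2
    nlinarith [abs_nonneg (inner ℝ η x : ℝ), abs_nonneg (inner ℝ η y : ℝ)]
  by_contra! hcon
  have hx' : |(inner ℝ η x : ℝ)| < |planeCross x y| / (‖x‖ + ‖y‖) := by
    by_contra! hle
    obtain ⟨a, b, hab⟩ := hsym ω ξ hle
    exact absurd hab (not_le.2 (hcon a b))
  have hy' : |(inner ℝ η y : ℝ)| < |planeCross x y| / (‖x‖ + ‖y‖) := by
    by_contra! hle
    obtain ⟨a, b, hab⟩ := hsym ω' ξ hle
    exact absurd hab (not_le.2 (hcon a b))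
  rw [lt_div_iff₀ hsum] at hx' hy'
  rcases (norm_nonneg x).eq_or_lt with h0 | h0
  · rw [← h0] at key hx' hy'
    nlinarith [abs_nonneg (inner ℝ η x : ℝ), norm_nonneg y]
  · have := mul_lt_mul_of_pos_right hy' h0
    have h3 := mul_le_mul_of_nonneg_right hx'.le (norm_nonneg y)
    nlinarith

/-! ### Cylinders do not end near a typical point -/

/-- Measured in the direction `η`, the cylinder of the word `w` does not begin within distance `r`
of the point `x`: if it has a point before `x + r`, then it has a point before `x - r`. -/
def NoEndNear (F : AffineIFS m) (w : List (Fin m)) (η x : Plane) (r : ℝ) : Prop :=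
  (∃ ξ, (inner ℝ η (F.canonicalProjection (prependWord w ξ) - x) : ℝ) ≤ r) →
    ∃ ξ, (inner ℝ η (F.canonicalProjection (prependWord w ξ) - x) : ℝ) < -r

/-- Almost surely, for all large `n`, none of the finitely many cylinders of level `J` ends near
the line through `π(σⁿω)` orthogonal to the long axis of `ω|ₙ`, if nearness is measured by a multiple
of the eccentricity of `ω|ₙ` and the eccentricity is exponentially small. The
long axis depends only on the first `n` letters and the point only on the other ones; these being
independent, the decay of the measure of strips and the Borel–Cantelli lemma apply. -/
theorem ae_eventually_noEndNear (F : AffineIFS m) (p : PMF (Fin m)) {C s : ℝ} (hC : 0 < C)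
    (hs : 0 < s)
    (hstrip : ∀ (η : Plane) (c ρ : ℝ), ‖η‖ = 1 → 0 < ρ →
      (bernoulliMeasure p).real (F.stripWords η c ρ) ≤ C * ρ ^ s)
    {K c₀ : ℝ} (hK : 0 < K) (hc₀ : 0 < c₀) (J : ℕ) :
    ∀ᵐ ω ∂(bernoulliMeasure p), ∀ᶠ n : ℕ in atTop,
      F.eccentricity (initialWord ω n) ≤ Real.exp (-(c₀ * n)) →
        ∀ w : List (Fin m), w.length = J → ∀ η : Plane,
          (η = F.longAxis (initialWord ω n) ∨ η = -F.longAxis (initialWord ω n)) →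
          F.NoEndNear w η (F.canonicalProjection (shiftWord n ω))
            (K * F.eccentricity (initialWord ω n)) := by
  classical
  let W : Finset (List (Fin m)) := (List.finite_length_eq (Fin m) J).toFinset
  let B : ℕ → Set (ℕ → Fin m) := fun n =>
    {ω | F.eccentricity (initialWord ω n) ≤ Real.exp (-(c₀ * n)) ∧ ∃ w ∈ W,
      ∃ η ∈ ({F.longAxis (initialWord ω n), -F.longAxis (initialWord ω n)} : Finset Plane),
        ¬ F.NoEndNear w η (F.canonicalProjection (shiftWord n ω))
            (K * F.eccentricity (initialWord ω n))}
  have hB : ∀ n, (bernoulliMeasure p).real (B n) ≤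
      2 * W.card * (C * K ^ s) * Real.exp (-(c₀ * s)) ^ n := by
    intro n
    refine bernoulliMeasure_real_le_of_forall p n _ fun u hu => ?_
    let H : Finset Plane := {F.longAxis u, -F.longAxis u}
    have hH : ∀ η ∈ H, ‖η‖ = 1 := by
      intro η hη
      rcases Finset.mem_insert.1 hη with rfl | hη
      · exact F.norm_longAxis u
      · rw [Finset.mem_singleton.1 hη, norm_neg, F.norm_longAxis]
    have hsub : prependWord u ⁻¹' B n ⊆ ⋃ w ∈ W, ⋃ η ∈ H, F.stripWords η
        (⨅ ξ, (inner ℝ η (F.canonicalProjection (prependWord w ξ)) : ℝ))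
        (K * Real.exp (-(c₀ * n))) := by
      rintro ω ⟨hecc, w, hw, η, hη, hend⟩
      subst hu
      rw [initialWord_prependWord] at hecc hη hend
      rw [shiftWord_prependWord] at hend
      refine mem_iUnion₂.2 ⟨w, hw, mem_iUnion₂.2 ⟨η, hη, ?_⟩⟩
      rw [NoEndNear, Classical.not_imp] at hend
      obtain ⟨⟨ξ₀, hξ₀⟩, hall⟩ := hend
      push Not at hall
      have hKle := mul_le_mul_of_nonneg_left hecc hK.le
      have hlow : ∀ ξ, (inner ℝ η (F.canonicalProjection ω) : ℝ) -
          K * Real.exp (-(c₀ * (u.length : ℕ))) ≤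
          inner ℝ η (F.canonicalProjection (prependWord w ξ)) := fun ξ => by
        have := hall ξ
        rw [inner_sub_right] at this
        linarith
      rw [inner_sub_right] at hξ₀
      have : Nonempty (ℕ → Fin m) := ⟨ξ₀⟩
      have h1 := le_ciInf hlow
      have h2 := ciInf_le ⟨_, forall_mem_range.2 hlow⟩ ξ₀
      change |(inner ℝ η (F.canonicalProjection ω) : ℝ) - _| ≤ _
      rw [abs_le]
      constructor <;> linarith
    refine (measureReal_mono hsub (measure_ne_top _ _)).trans ((measureReal_biUnion_finset_le _ _).trans ?_)
    calc _ ≤ ∑ w ∈ W, ∑ η ∈ H, C * (K * Real.exp (-(c₀ * n))) ^ s := by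
          refine Finset.sum_le_sum fun w _ => (measureReal_biUnion_finset_le _ _).trans ?_
          exact Finset.sum_le_sum fun η hη => hstrip η _ _ (hH η hη) (by positivity)
      _ = H.card * W.card * (C * (K * Real.exp (-(c₀ * n))) ^ s) := by
          simp only [Finset.sum_const, nsmul_eq_mul]; ring
      _ ≤ 2 * W.card * (C * (K * Real.exp (-(c₀ * n))) ^ s) := by
          have : (H.card : ℝ) ≤ 2 := by exact_mod_cast Finset.card_le_two
          gcongr
      _ = _ := by
          rw [Real.mul_rpow hK.le (Real.exp_pos _).le, ← Real.exp_mul, ← Real.exp_nat_mul]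
          ring_nf
  have hsum : Summable fun n : ℕ => 2 * W.card * (C * K ^ s) * Real.exp (-(c₀ * s)) ^ n := by
    refine (summable_geometric_of_lt_one (Real.exp_pos _).le ?_).mul_left _
    rw [Real.exp_lt_one_iff]
    have := mul_pos hc₀ hs
    linarith
  have htsum : ∑' n, bernoulliMeasure p (B n) ≠ ⊤ := by
    refine ne_top_of_le_ne_top hsum.tsum_ofReal_ne_top (ENNReal.tsum_le_tsum fun n => ?_)
    rw [← ofReal_measureReal]
    exact ENNReal.ofReal_le_ofReal (hB n)
  filter_upwards [ae_eventually_notMem htsum] with ω hω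
  filter_upwards [hω] with n hn hecc w hw η hη
  by_contra hend
  refine hn ⟨hecc, w, by simpa [W] using hw, η, by simpa using hη, hend⟩

/-! ### Eccentricities decay exponentially -/

theorem exists_tendsto_log_singularValue_mul (F : AffineIFS m) (p : PMF (Fin m)) :
    ∃ c : ℝ, ∀ᵐ ω ∂(bernoulliMeasure p), Tendsto (fun n : ℕ => -(1 / (n : ℝ)) *
      (Real.log (F.singularValue 0 (initialWord ω n)) +
        Real.log (F.singularValue 1 (initialWord ω n)))) atTop (𝓝 c) := by
  let d : Fin m → ℝ := fun i => Real.log |LinearMap.det (F.linear i : Plane →ₗ[ℝ] Plane)|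
  have hd : Measurable d := measurable_of_finite d
  have hlog : ∀ (ω : ℕ → Fin m) (n : ℕ), Real.log (F.singularValue 0 (initialWord ω n)) +
      Real.log (F.singularValue 1 (initialWord ω n)) = ∑ i ∈ Finset.range n, d (ω i) := by
    intro ω n
    rw [← Real.log_mul (F.singularValue_pos _ _).ne' (F.singularValue_pos _ _).ne',
      singularValue_mul]
    induction n with
    | zero => simp
    | succ n ih =>
      have h1 : LinearMap.det (F.wordLinear (initialWord ω n) : Plane →ₗ[ℝ] Plane) ≠ 0 := by
        rw [← abs_pos, ← singularValue_mul]
        exact mul_pos (F.singularValue_pos _ _) (F.singularValue_pos _ _)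
      have h2 : LinearMap.det (F.linear (ω n) : Plane →ₗ[ℝ] Plane) ≠ 0 := by
        have : F.linear (ω n) = F.wordLinear [ω n] := by simp
        rw [this, ← abs_pos, ← singularValue_mul]
        exact mul_pos (F.singularValue_pos _ _) (F.singularValue_pos _ _)
      rw [Finset.sum_range_succ, ← ih, initialWord_succ, wordLinear_append,
        ContinuousLinearMap.toLinearMap_mul, map_mul, abs_mul,
        Real.log_mul (abs_ne_zero.2 h1) (by simpa using h2)]
      simp [d]
  have hmp : ∀ i, MeasurePreserving (Function.eval i) (bernoulliMeasure p) p.toMeasure := fun i =>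
    measurePreserving_eval_infinitePi (fun _ : ℕ => p.toMeasure) i
  have hslln := ProbabilityTheory.strong_law_ae_real (μ := bernoulliMeasure p)
    (fun i ω => d (ω i)) ?_ ?_ ?_
  · refine ⟨-∫ ω, d (ω 0) ∂(bernoulliMeasure p), ?_⟩
    filter_upwards [hslln] with ω hω
    refine hω.neg.congr fun n => ?_
    rw [hlog]
    ring
  · exact ((hmp 0).integrable_comp hd.aestronglyMeasurable).2 Integrable.of_finite
  · intro i j hij
    exact (ProbabilityTheory.iIndepFun_infinitePi (P := fun _ : ℕ => p.toMeasure)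
      (X := fun _ => d) fun _ => hd).indepFun hij
  · intro i
    refine ⟨(hd.comp (measurable_pi_apply i)).aemeasurable,
      (hd.comp (measurable_pi_apply 0)).aemeasurable, ?_⟩
    have : ∀ i, (bernoulliMeasure p).map (fun ω => d (ω i)) = p.toMeasure.map d := fun i => by
      rw [← (hmp i).map_eq, Measure.map_map hd (measurable_pi_apply i)]; rfl
    rw [this, this]

/-- If the Lyapunov exponents are different, then both of them are limits: the sum of the two
sequences converges by the law of large numbers, so that one of them converges if and only if the
other one does, and two divergent sequences would be given the same default value `0`. -/
theorem ae_eventually_eccentricity_le (F : AffineIFS m) (p : PMF (Fin m))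
    (h : F.lyapunovExponent p 0 < F.lyapunovExponent p 1) :
    ∃ c₀ : ℝ, 0 < c₀ ∧ ∀ᵐ ω ∂(bernoulliMeasure p), ∀ᶠ n : ℕ in atTop,
      F.eccentricity (initialWord ω n) ≤ Real.exp (-(c₀ * n)) := by
  obtain ⟨c, hc⟩ := F.exists_tendsto_log_singularValue_mul p
  have h01 : (∃ x, F.IsLyapunovExponent p 0 x) ↔ ∃ x, F.IsLyapunovExponent p 1 x := by
    constructor
    · rintro ⟨x, hx⟩
      refine ⟨c - x, ?_⟩
      filter_upwards [hx, hc] with ω h1 h2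
      exact (h2.sub h1).congr fun n => by ring
    · rintro ⟨x, hx⟩
      refine ⟨c - x, ?_⟩
      filter_upwards [hx, hc] with ω h1 h2
      exact (h2.sub h1).congr fun n => by ring
  have h0 : ∃ x, F.IsLyapunovExponent p 0 x := by
    by_contra hno
    have hno' := fun h' => hno (h01.2 h')
    rw [lyapunovExponent, lyapunovExponent, dif_neg hno, dif_neg hno'] at h
    exact lt_irrefl _ h
  have h1 := h01.1 h0
  rw [lyapunovExponent, lyapunovExponent, dif_pos h0, dif_pos h1] at h
  refine ⟨(h1.choose - h0.choose) / 2, by linarith, ?_⟩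
  filter_upwards [h0.choose_spec, h1.choose_spec] with ω hω0 hω1
  have hlt : (h1.choose - h0.choose) / 2 < h1.choose - h0.choose := by linarith
  filter_upwards [(hω1.sub hω0).eventually_const_lt hlt, eventually_gt_atTop 0] with n hn hn0
  have hn0' : (0 : ℝ) < n := by exact_mod_cast hn0
  rw [← Real.log_le_iff_le_exp (F.eccentricity_pos _), eccentricity,
    Real.log_div (F.singularValue_pos _ _).ne' (F.singularValue_pos _ _).ne']
  have := mul_lt_mul_of_pos_right hn hn0'
  have e : (-(1 / (n : ℝ)) * Real.log (F.singularValue 1 (initialWord ω n)) -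
      -(1 / (n : ℝ)) * Real.log (F.singularValue 0 (initialWord ω n))) * n =
      Real.log (F.singularValue 0 (initialWord ω n)) -
        Real.log (F.singularValue 1 (initialWord ω n)) := by
    field_simp
    ring
  rw [e] at this
  linarith

end AffineIFS

namespace AffineIFS

variable {m : ℕ} {F : AffineIFS m} {E : Set Plane}

/-! ### Typical words and the scales of their cylinders -/

/-- Constants of a strongly separated self-affine set: bounds `a` and `β` for the contraction
ratios, a bound `D` for the diameter, and a lower bound `δ` for the mutual distances of the first
level cylinders. -/
structure HasConstants (F : AffineIFS m) (E : Set Plane) (a β D δ : ℝ) : Prop where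
  isSelfAffineSet : F.IsSelfAffineSet E
  a_pos : 0 < a
  a_lt_one : a < 1
  β_pos : 0 < β
  β_lt_one : β < 1
  D_pos : 0 < D
  δ_pos : 0 < δ
  le_singularValue : ∀ i, a ≤ F.singularValue 1 [i]
  norm_linear_le : ∀ i, ‖F.linear i‖ ≤ β
  norm_sub_le : ∀ ω ω' : ℕ → Fin m, ‖F.canonicalProjection ω - F.canonicalProjection ω'‖ ≤ D
  lt_dist : ∀ i j, i ≠ j → ∀ x ∈ F.toMap i '' E, ∀ y ∈ F.toMap j '' E, δ < dist x y

theorem exists_hasConstants (hE : F.IsSelfAffineSet E) (hsep : F.StrongSeparation E) :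
    ∃ a β D δ : ℝ, F.HasConstants E a β D δ := by
  obtain ⟨a, β, ha0, ha1, hβ0, hβ1, ha, hβ⟩ := F.exists_ratio_bounds
  obtain ⟨D, hD0, hD⟩ := F.exists_dist_canonicalProjection_le
  obtain ⟨δ, hδ0, hδ⟩ := hsep
  exact ⟨a, β, D, δ, hE, ha0, ha1, hβ0, hβ1, hD0, hδ0, ha, hβ, hD, hδ⟩

/-- The properties of almost every infinite word that determine the tangent sets at its projection:
the cylinders along `ω` become thin, `v` is the direction of their long axes, the subcylinders
have connected projections in this direction, and they do not end near `π(ω)` at the relevant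
scales. -/
structure IsTypical (F : AffineIFS m) (ω : ℕ → Fin m) (v : Plane) (K : ℝ) : Prop where
  norm_eq_one : ‖v‖ = 1
  tendsto_eccentricity : Tendsto (fun n => F.eccentricity (initialWord ω n)) atTop (𝓝 0)
  tendsto_planeCross :
    Tendsto (fun n => planeCross (F.principalDirection (initialWord ω n)) v) atTop (𝓝 0)
  isPreconnected : ∀ᶠ n in atTop, ∀ w : List (Fin m), IsPreconnected (range fun ξ =>
    (inner ℝ v (F.canonicalProjection (prependWord (initialWord ω n ++ w) ξ)) : ℝ))
  noEndNear : ∀ J : ℕ, ∀ᶠ n in atTop, ∀ w : List (Fin m), w.length = J → ∀ η : Plane,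
    (η = F.longAxis (initialWord ω n) ∨ η = -F.longAxis (initialWord ω n)) →
    F.NoEndNear w η (F.canonicalProjection (shiftWord n ω)) (K * F.eccentricity (initialWord ω n))

variable {a β D δ : ℝ}

namespace HasConstants

theorem singularValue_append_le (h : F.HasConstants E a β D δ) (w w' : List (Fin m)) :
    F.singularValue 1 (w ++ w') ≤ F.singularValue 1 w * β ^ w'.length :=
  (F.singularValue_one_append_le w w').trans (mul_le_mul_of_nonneg_left
    (F.singularValue_zero_le_pow h.β_pos.le h.norm_linear_le w') (F.singularValue_nonneg _ _))

theorem le_singularValue_append (h : F.HasConstants E a β D δ) (w w' : List (Fin m)) :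
    F.singularValue 1 w * a ^ w'.length ≤ F.singularValue 1 (w ++ w') :=
  (mul_le_mul_of_nonneg_left (F.pow_le_singularValue_one h.a_pos.le h.le_singularValue w')
    (F.singularValue_nonneg _ _)).trans (F.singularValue_one_mul_le_append w w')

theorem initialWord_eq (h : F.HasConstants E a β D δ) {ω ω' : ℕ → Fin m} {n : ℕ} {t : ℝ}
    (h1 : ‖F.canonicalProjection ω - F.canonicalProjection ω'‖ ≤ t)
    (h2 : t ≤ δ * F.singularValue 1 (initialWord ω n)) : initialWord ω n = initialWord ω' n :=
  initialWord_eq_of_dist_le h.isSelfAffineSet h.lt_dist h.δ_pos n (h1.trans h2)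

/-- Every small scale `t` is comparable to the width `α₂` of a cylinder along the word. -/
theorem exists_scale (h : F.HasConstants E a β D δ) (ω : ℕ → Fin m) {n : ℕ} {t : ℝ} (ht : 0 < t)
    (htn : t ≤ δ * F.singularValue 1 (initialWord ω n)) : ∃ k : ℕ,
      a * δ * F.singularValue 1 (initialWord ω (n + k)) < t ∧
      t ≤ δ * F.singularValue 1 (initialWord ω (n + k)) := by
  have hex : ∃ k : ℕ, δ * F.singularValue 1 (initialWord ω (n + k)) < t := by
    have hpos := mul_pos h.δ_pos (F.singularValue_pos 1 (initialWord ω n))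
    obtain ⟨k, hk⟩ := exists_pow_lt_of_lt_one (div_pos ht hpos) h.β_lt_one
    refine ⟨k, ?_⟩
    rw [lt_div_iff₀ hpos] at hk
    have := h.singularValue_append_le (initialWord ω n) (initialWord (shiftWord n ω) k)
    rw [length_initialWord, ← initialWord_add] at this
    nlinarith [mul_le_mul_of_nonneg_left this h.δ_pos.le]
  classical
  have hspec := Nat.find_spec hex
  have hmin := fun j => Nat.find_min hex (m := j)
  cases hk : Nat.find hex with
  | zero => rw [hk] at hspec; exact absurd htn (not_le.2 hspec)
  | succ k =>
    rw [hk] at hspec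
    refine ⟨k, lt_of_le_of_lt ?_ hspec, not_lt.1 (hmin k (by omega))⟩
    rw [← add_assoc, initialWord_succ]
    have := h.le_singularValue_append (initialWord ω (n + k)) [ω (n + k)]
    rw [List.length_singleton, pow_one] at this
    nlinarith [mul_le_mul_of_nonneg_left this h.δ_pos.le]

/-- A property of all large levels holds at the levels of all small scales. -/
theorem eventually_of_scale (h : F.HasConstants E a β D δ) (ω : ℕ → Fin m) {P : ℕ → Prop}
    (hP : ∀ᶠ n in atTop, P n) : ∀ᶠ t in 𝓝[>] (0 : ℝ), ∀ n : ℕ,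
      a * δ * F.singularValue 1 (initialWord ω n) < t → P n := by
  obtain ⟨M, hM⟩ := eventually_atTop.1 hP
  have hpos : 0 < a * δ * a ^ M :=
    mul_pos (mul_pos h.a_pos h.δ_pos) (pow_pos h.a_pos M)
  filter_upwards [Ioo_mem_nhdsGT hpos] with t ht n hn
  refine hM n ?_
  by_contra! hlt
  have h1 := F.pow_le_singularValue_one h.a_pos.le h.le_singularValue (initialWord ω n)
  rw [length_initialWord] at h1
  have h2 : a ^ M ≤ a ^ n := pow_le_pow_of_le_one h.a_pos.le h.a_lt_one.le hlt.le
  have h3 := mul_le_mul_of_nonneg_left (h2.trans h1) (mul_pos h.a_pos h.δ_pos).le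
  linarith [ht.2]

end HasConstants

/-! ### The fibre structure of the tangent sets -/

/-- A cylinder that meets a ball of radius `t ≤ δ α₂` around the image of `y` leaves it in the
direction `η`, provided that it does not end near `y` with respect to `η`. Here `g` stands for
`⟪η, · - y⟫` and `G` for the projection of the image to the limiting direction. -/
theorem exists_of_noEndNear {ι : Type*} {g G : ι → ℝ} {c s₁ s₂ t : ℝ} (hs₁ : 0 < s₁)
    (hs₂ : 0 < s₂) (hc : 1 / 2 ≤ |c|) (ht : t ≤ δ * s₂) (hδ : 0 < δ) (hD : 0 < D)
    (hG : ∀ ξ, |G ξ - c * (s₁ * g ξ)| ≤ s₂ * D) {ξ₀ : ι} (hξ₀ : |G ξ₀| ≤ t)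
    (hend : (∃ ξ, g ξ ≤ 2 * (δ + D) * (s₂ / s₁)) → ∃ ξ, g ξ < -(2 * (δ + D) * (s₂ / s₁))) :
    ∃ ξ, (0 < c → G ξ < -t) ∧ (c < 0 → t < G ξ) := by
  have hKs : 2 * (δ + D) * (s₂ / s₁) * s₁ = 2 * (δ + D) * s₂ := by field_simp
  have hg₀ : g ξ₀ ≤ 2 * (δ + D) * (s₂ / s₁) := by
    have h1 : |c * (s₁ * g ξ₀)| ≤ t + s₂ * D := by
      have := abs_sub_abs_le_abs_sub (c * (s₁ * g ξ₀)) (G ξ₀)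
      rw [abs_sub_comm] at this
      linarith [hG ξ₀]
    rw [abs_mul] at h1
    have h2 : 1 / 2 * |s₁ * g ξ₀| ≤ (δ + D) * s₂ :=
      (mul_le_mul_of_nonneg_right hc (abs_nonneg _)).trans (h1.trans (by linarith))
    have h3 := le_abs_self (s₁ * g ξ₀)
    refine le_of_mul_le_mul_right ?_ hs₁
    rw [hKs]
    linarith
  obtain ⟨ξ, hξ⟩ := hend ⟨ξ₀, hg₀⟩
  have h4 : s₁ * g ξ < -(2 * (δ + D) * s₂) := by
    have := mul_lt_mul_of_pos_right hξ hs₁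
    rw [neg_mul, hKs] at this
    linarith
  have h5 := abs_le.1 (hG ξ)
  have hpos : 0 < (δ + D) * s₂ := mul_pos (by linarith) hs₂
  refine ⟨ξ, fun hc0 => ?_, fun hc0 => ?_⟩
  · rw [abs_of_pos hc0] at hc
    have h6 := mul_lt_mul_of_pos_left h4 hc0
    have h7 := mul_le_mul_of_nonneg_right hc hpos.le
    nlinarith [h5.2]
  · rw [abs_of_neg hc0] at hc
    have h6 := mul_lt_mul_of_neg_left h4 hc0
    have h7 := mul_le_mul_of_nonneg_right hc hpos.le
    nlinarith [h5.1]

/-- At small scales, `E` looks like a union of line segments that cross the ball around `π(ω)` in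
the direction `v`: up to a small vertical error, every point of the ball can be moved inside `E` to
any prescribed horizontal position. -/
theorem IsTypical.eventually_crossing {ω : ℕ → Fin m} {v : Plane}
    (h : F.HasConstants E a β D δ) (hω : F.IsTypical ω v (2 * (δ + D))) {ρ : ℝ} (hρ : 0 < ρ) :
    ∀ᶠ t in 𝓝[>] (0 : ℝ), ∀ z ∈ E, ‖z - F.canonicalProjection ω‖ ≤ t → ∀ τ : ℝ, |τ| ≤ 1 →
      ∃ z' ∈ E, (inner ℝ v (z' - F.canonicalProjection ω) : ℝ) = τ * t ∧
        |planeCross v (z' - z)| ≤ ρ * t := by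
  have haδ : 0 < a * δ := mul_pos h.a_pos h.δ_pos
  obtain ⟨J, hJ⟩ := exists_pow_lt_of_lt_one
    (show 0 < min (ρ / 2) 1 * (a * δ) / D from
      div_pos (mul_pos (lt_min (by linarith) one_pos) haδ) h.D_pos) h.β_lt_one
  rw [lt_div_iff₀ h.D_pos] at hJ
  have hs : ∀ᶠ n in atTop, |planeCross (F.principalDirection (initialWord ω n)) v| <
      min (ρ / 12) (1 / 2) := by
    have := hω.tendsto_planeCross.abs
    rw [abs_zero] at this
    exact this.eventually_lt_const (lt_min (by linarith) (by norm_num))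
  have hev := h.eventually_of_scale ω (hs.and (hω.isPreconnected.and (hω.noEndNear J)))
  filter_upwards [hev, Ioc_mem_nhdsGT h.δ_pos] with t ht htδ z hz hzt τ hτ
  obtain ⟨n, hn1, hn2⟩ := h.exists_scale ω (n := 0) htδ.1 (by
    rw [initialWord_zero, singularValue_nil, mul_one]; exact htδ.2)
  rw [zero_add] at hn1 hn2
  obtain ⟨hcr, hconn, hend⟩ := ht n hn1
  rw [← h.isSelfAffineSet.range_canonicalProjection] at hz
  obtain ⟨ω', rfl⟩ := hz
  rw [norm_sub_rev] at hzt
  have hword := h.initialWord_eq hzt hn2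
  set A := F.wordLinear (initialWord ω n) with hA
  set u := F.principalDirection (initialWord ω n) with hu
  set η := F.longAxis (initialWord ω n) with hη
  set y := F.canonicalProjection (shiftWord n ω) with hy
  set j := initialWord (shiftWord n ω') J with hj
  set s₁ := F.singularValue 0 (initialWord ω n) with hs₁
  set s₂ := F.singularValue 1 (initialWord ω n) with hs₂
  have hs₁0 : 0 < s₁ := F.singularValue_pos _ _
  have hs₂0 : 0 < s₂ := F.singularValue_pos _ _
  have hu1 : ‖u‖ = 1 := F.norm_principalDirection _
  have hc := half_le_abs_inner hu1 hω.norm_eq_one (hcr.le.trans (min_le_right _ _))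
  -- the points of the cylinder of `ω|ₙ j`, which contains the given point `z = π(ω')`
  let Y : (ℕ → Fin m) → Plane := fun ξ => F.canonicalProjection (prependWord j ξ)
  let Z : (ℕ → Fin m) → Plane := fun ξ =>
    F.canonicalProjection (prependWord (initialWord ω n ++ j) ξ)
  have hZ : ∀ ξ, Z ξ - F.canonicalProjection ω = A (Y ξ - y) := by
    intro ξ
    simp only [Z, Y]
    rw [canonicalProjection_prependWord, wordMap_append, Function.comp_apply,
      ← canonicalProjection_prependWord, F.canonicalProjection_eq_wordMap ω n, wordMap_sub]
  have hZ' : Z (shiftWord (n + J) ω') = F.canonicalProjection ω' := by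
    simp only [Z]
    rw [hword, hj, ← initialWord_add, canonicalProjection_prependWord,
      ← canonicalProjection_eq_wordMap]
  set ξ₀ := shiftWord (n + J) ω' with hξ₀
  have hY : ∀ ξ, ‖Y ξ - Y ξ₀‖ ≤ β ^ J * D := by
    intro ξ
    simp only [Y]
    rw [canonicalProjection_prependWord, canonicalProjection_prependWord, wordMap_sub]
    refine (F.norm_wordLinear_apply_le _ _).trans (mul_le_mul ?_ (h.norm_sub_le _ _)
      (norm_nonneg _) (pow_nonneg h.β_pos.le _))
    have := F.singularValue_zero_le_pow h.β_pos.le h.norm_linear_le j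
    rwa [hj, length_initialWord] at this
  set c : ℝ := inner ℝ u v with hcdef
  set s : ℝ := planeCross u v with hsdef
  let G : (ℕ → Fin m) → ℝ := fun ξ => inner ℝ v (Z ξ - F.canonicalProjection ω)
  have hGerr : ∀ ξ, |G ξ - c * (s₁ * inner ℝ η (Y ξ - y))| ≤ s₂ * D := by
    intro ξ
    have e : G ξ - c * (s₁ * inner ℝ η (Y ξ - y)) = s * planeCross u (A (Y ξ - y)) := by
      simp only [G]
      rw [hZ, plane_inner_eq_of_norm_eq_one hu1, F.inner_principalDirection]
      ring
    rw [e, abs_mul]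
    have h1 := F.abs_planeCross_principalDirection_le (initialWord ω n) (Y ξ - y)
    have h2 := mul_le_mul_of_nonneg_left (h.norm_sub_le (prependWord j ξ) (shiftWord n ω)) hs₂0.le
    have h3 := abs_planeCross_le_one hu1 hω.norm_eq_one
    calc |s| * |planeCross u (A (Y ξ - y))| ≤ 1 * (s₂ * D) :=
          mul_le_mul h3 (h1.trans h2) (abs_nonneg _) zero_le_one
      _ = s₂ * D := one_mul _
  have hG₀ : |G ξ₀| ≤ t := by
    simp only [G]
    rw [hZ']
    refine (abs_real_inner_le_norm _ _).trans ?_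
    rw [hω.norm_eq_one, one_mul, norm_sub_rev]
    exact hzt
  have hjl : j.length = J := by rw [hj, length_initialWord]
  obtain ⟨ξ₁, h11, h12⟩ := exists_of_noEndNear (δ := δ) (D := D) hs₁0 hs₂0 hc hn2 h.δ_pos h.D_pos
    hGerr hG₀ (hend j hjl η (Or.inl rfl))
  obtain ⟨ξ₂, h21, h22⟩ := exists_of_noEndNear (δ := δ) (D := D) (c := -c)
    (g := fun ξ => inner ℝ (-η) (Y ξ - y)) hs₁0 hs₂0 (by rwa [abs_neg]) hn2 h.δ_pos h.D_pos
    (fun ξ => by rw [inner_neg_left, neg_mul_comm, ← mul_neg, neg_neg]; exact hGerr ξ) hG₀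
    (hend j hjl (-η) (Or.inr rfl))
  obtain ⟨ξl, ξr, hl, hr⟩ : ∃ ξl ξr, G ξl < -t ∧ t < G ξr := by
    rcases lt_or_gt_of_ne (abs_pos.1 (lt_of_lt_of_le (by norm_num) hc)) with hc0 | hc0
    · exact ⟨ξ₂, ξ₁, h21 (by linarith), h12 hc0⟩
    · exact ⟨ξ₁, ξ₂, h11 hc0, h22 (by linarith)⟩
  have hτt : |τ * t| ≤ t := by
    rw [abs_mul, abs_of_pos htδ.1]; exact mul_le_of_le_one_left htδ.1.le hτ
  obtain ⟨ξ, hξ⟩ : ∃ ξ, G ξ = τ * t := by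
    have hGv : ∀ ξ, G ξ = inner ℝ v (Z ξ) - inner ℝ v (F.canonicalProjection ω) := fun ξ =>
      inner_sub_right _ _ _
    obtain ⟨ξ, hξ⟩ := (hconn j).Icc_subset (mem_range_self ξl) (mem_range_self ξr)
      (show τ * t + inner ℝ v (F.canonicalProjection ω) ∈ _ from by
        have hb := abs_le.1 hτt
        have hl' := hGv ξl
        have hr' := hGv ξr
        simp only [Z] at hl' hr'
        exact ⟨by linarith [hb.1], by linarith [hb.2]⟩)
    refine ⟨ξ, ?_⟩
    rw [hGv]
    simp only [Z]
    simp only at hξ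
    linarith
  refine ⟨Z ξ, h.isSelfAffineSet.canonicalProjection_mem _, hξ, ?_⟩
  set P := Z ξ - F.canonicalProjection ω' with hP
  have hPA : P = A (Y ξ - Y ξ₀) := by
    rw [hP, ← hZ', ← sub_sub_sub_cancel_right _ _ (F.canonicalProjection ω), hZ, hZ, ← map_sub,
      sub_sub_sub_cancel_right]
  have hPu : |planeCross u P| ≤ min (ρ / 2) 1 * t := by
    rw [hPA]
    have h1 := (F.abs_planeCross_principalDirection_le (initialWord ω n) (Y ξ - Y ξ₀)).trans
      (mul_le_mul_of_nonneg_left (hY ξ) hs₂0.le)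
    have h2 := mul_le_mul_of_nonneg_left hJ.le hs₂0.le
    have h3 : 0 ≤ min (ρ / 2) 1 := le_min (by linarith) zero_le_one
    have h4 := mul_le_mul_of_nonneg_left hn1.le h3
    calc |planeCross u (A (Y ξ - Y ξ₀))| ≤ s₂ * (β ^ J * D) := h1
      _ ≤ s₂ * (min (ρ / 2) 1 * (a * δ)) := h2
      _ = min (ρ / 2) 1 * (a * δ * s₂) := by ring
      _ ≤ _ := h4
  have hPv : |(inner ℝ v P : ℝ)| ≤ 2 * t := by
    have e : (inner ℝ v P : ℝ) = G ξ - G ξ₀ := by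
      simp only [G]
      rw [hZ', ← inner_sub_right, sub_sub_sub_cancel_right]
    rw [e, hξ]
    exact (abs_sub _ _).trans (by linarith)
  have hPuin : |(inner ℝ u P : ℝ)| ≤ 6 * t := by
    have e := plane_inner_eq_of_norm_eq_one hu1 v P
    have h1 : |c * (inner ℝ u P : ℝ)| ≤ 3 * t := by
      have h2 : c * (inner ℝ u P : ℝ) = inner ℝ v P - s * planeCross u P := by linarith
      rw [h2]
      refine (abs_sub _ _).trans ?_
      rw [abs_mul]
      have h3 := mul_le_mul (abs_planeCross_le_one hu1 hω.norm_eq_one) hPu (abs_nonneg _) zero_le_one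
      have h4 : min (ρ / 2) 1 * t ≤ 1 * t := mul_le_mul_of_nonneg_right (min_le_right _ _) htδ.1.le
      linarith
    rw [abs_mul] at h1
    have := mul_le_mul_of_nonneg_right hc (abs_nonneg (inner ℝ u P : ℝ))
    linarith
  rw [planeCross_eq_of_norm_eq_one hu1]
  refine (abs_sub _ _).trans ?_
  rw [abs_mul, abs_mul]
  have h1 := mul_le_mul (abs_inner_le_one hu1 hω.norm_eq_one) hPu (abs_nonneg _) zero_le_one
  have h2 := mul_le_mul (hcr.le.trans (min_le_left _ _)) hPuin (abs_nonneg _) (by linarith)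
  have h3 : min (ρ / 2) 1 * t ≤ ρ / 2 * t := mul_le_mul_of_nonneg_right (min_le_left _ _) htδ.1.le
  linarith

/-- A chain of points of `E` with small steps, compared to a scale `r t`, stays inside a small
cylinder, whose height is much smaller than `r t`. -/
theorem IsTypical.exists_chain_bound {ω : ℕ → Fin m} {v : Plane} {K : ℝ}
    (h : F.HasConstants E a β D δ) (hω : F.IsTypical ω v K) :
    ∃ κ : ℝ, 0 < κ ∧ ∀ r : ℝ, 0 < r → r ≤ 1 → ∀ᶠ t in 𝓝[>] (0 : ℝ),
      ∀ (ζ : ℕ → ℕ → Fin m) (L : ℕ),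
      ‖F.canonicalProjection (ζ 0) - F.canonicalProjection ω‖ ≤ t →
      (∀ l < L, ‖F.canonicalProjection (ζ (l + 1)) - F.canonicalProjection (ζ l)‖ ≤ κ * (r * t)) →
      ‖F.canonicalProjection (ζ L) - F.canonicalProjection (ζ 0)‖ ≤ r * t →
      |planeCross v (F.canonicalProjection (ζ L) - F.canonicalProjection (ζ 0))| ≤ r * t / 8 := by
  have haδ : 0 < a * δ := mul_pos h.a_pos h.δ_pos
  obtain ⟨q, hq⟩ := exists_pow_lt_of_lt_one
    (show 0 < 1 / 16 * (a * δ) / D from div_pos (mul_pos (by norm_num) haδ) h.D_pos) h.β_lt_one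
  rw [lt_div_iff₀ h.D_pos] at hq
  refine ⟨a ^ q, pow_pos h.a_pos q, fun r hr0 hr1 => ?_⟩
  obtain ⟨M, hM⟩ := exists_pow_lt_of_lt_one (mul_pos h.a_pos hr0) h.β_lt_one
  have haM : 0 < a ^ M := pow_pos h.a_pos M
  have h1 : ∀ᶠ n in atTop, |planeCross (F.principalDirection (initialWord ω n)) v| < 1 / 32 := by
    have := hω.tendsto_planeCross.abs
    rw [abs_zero] at this
    exact this.eventually_lt_const (by norm_num)
  have h2 : ∀ᶠ n in atTop, F.eccentricity (initialWord ω n) < a ^ M / 32 :=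
    hω.tendsto_eccentricity.eventually_lt_const (by positivity)
  filter_upwards [h.eventually_of_scale ω (h1.and h2), Ioc_mem_nhdsGT h.δ_pos]
    with t ht htδ ζ L hζ0 hstep hζL
  obtain ⟨n, hn1, hn2⟩ := h.exists_scale ω (n := 0) htδ.1 (by
    rw [initialWord_zero, singularValue_nil, mul_one]; exact htδ.2)
  rw [zero_add] at hn1 hn2
  obtain ⟨hcr, hecc⟩ := ht n hn1
  rw [norm_sub_rev] at hζ0
  have hword := h.initialWord_eq hζ0 hn2
  have hrt : 0 < r * t := mul_pos hr0 htδ.1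
  obtain ⟨k, hk1, hk2⟩ := h.exists_scale (ζ 0) (n := n) hrt (by
    rw [← hword]; exact (mul_le_of_le_one_left htδ.1.le hr1).trans hn2)
  set w := initialWord (ζ 0) (n + k) with hw
  set j := initialWord (shiftWord n (ζ 0)) k with hj
  have hwj : w = initialWord ω n ++ j := by rw [hw, initialWord_add, hword]
  have hjl : j.length = k := length_initialWord _ _
  -- the whole chain lies in one cylinder of level `n + k + q`
  have hchain : ∀ l ≤ L, initialWord (ζ l) (n + k + q) = initialWord (ζ 0) (n + k + q) := by
    intro l
    induction l with
    | zero => intro _; rfl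
    | succ l ih =>
      intro hl
      have hprev := ih (by omega)
      have hst := hstep l (by omega)
      rw [norm_sub_rev] at hst
      rw [← hprev]
      refine (h.initialWord_eq hst ?_).symm
      rw [hprev, initialWord_add (ζ 0) (n + k) q]
      have e := h.le_singularValue_append (initialWord (ζ 0) (n + k))
        (initialWord (shiftWord (n + k) (ζ 0)) q)
      rw [length_initialWord] at e
      calc a ^ q * (r * t) ≤ a ^ q * (δ * F.singularValue 1 (initialWord (ζ 0) (n + k))) :=
            mul_le_mul_of_nonneg_left hk2 (pow_nonneg h.a_pos.le q)
        _ = δ * (F.singularValue 1 (initialWord (ζ 0) (n + k)) * a ^ q) := by ring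
        _ ≤ _ := mul_le_mul_of_nonneg_left e h.δ_pos.le
  set P := F.canonicalProjection (ζ L) - F.canonicalProjection (ζ 0) with hP
  set u := F.principalDirection w with hu
  have hu1 : ‖u‖ = 1 := F.norm_principalDirection _
  have hPu : |planeCross u P| ≤ r * t / 16 := by
    have e := F.canonicalProjection_sub_of_initialWord_eq (hchain L le_rfl)
    rw [hchain L le_rfl, initialWord_add (ζ 0) (n + k) q, wordLinear_append, ← hw, ← hP,
      mul_apply_eq_comp] at e
    rw [e]
    refine (F.abs_planeCross_principalDirection_le w _).trans ?_
    have e1 := (F.norm_wordLinear_apply_le (initialWord (shiftWord (n + k) (ζ 0)) q)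
      (F.canonicalProjection (shiftWord (n + k + q) (ζ L)) -
        F.canonicalProjection (shiftWord (n + k + q) (ζ 0)))).trans
      (mul_le_mul (F.singularValue_zero_le_pow h.β_pos.le h.norm_linear_le _) (h.norm_sub_le _ _)
        (norm_nonneg _) (pow_nonneg h.β_pos.le _))
    rw [length_initialWord] at e1
    have e2 := mul_le_mul_of_nonneg_left (e1.trans hq.le) (F.singularValue_nonneg 1 w)
    refine e2.trans ?_
    linarith
  -- the long axis of the small cylinder is nearly parallel to `v`
  have huv : |planeCross u v| ≤ 1 / 16 := by
    have hkM : k < M := by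
      by_contra! hle
      have e1 := h.singularValue_append_le (initialWord ω n) j
      rw [← hwj, hjl] at e1
      have e2 : β ^ k ≤ β ^ M := pow_le_pow_of_le_one h.β_pos.le h.β_lt_one.le hle
      have hs := F.singularValue_pos 1 (initialWord ω n)
      have e3 := mul_lt_mul_of_pos_left (e2.trans_lt hM) hs
      have e4 := mul_lt_mul_of_pos_left hn1 hr0
      have e5 := mul_le_mul_of_nonneg_left e1 h.δ_pos.le
      have e6 := mul_lt_mul_of_pos_left e3 h.δ_pos
      linarith
    have hj1 : F.singularValue 0 j / F.singularValue 1 j ≤ 1 / a ^ M := by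
      refine div_le_div₀ zero_le_one ?_ haM ?_
      · exact (F.singularValue_zero_le_pow h.β_pos.le h.norm_linear_le _).trans
          (pow_le_one₀ h.β_pos.le h.β_lt_one.le)
      · refine le_trans ?_ (F.pow_le_singularValue_one h.a_pos.le h.le_singularValue j)
        rw [hjl]
        exact pow_le_pow_of_le_one h.a_pos.le h.a_lt_one.le hkM.le
    have e1 := F.abs_planeCross_principalDirection_append_le (initialWord ω n) j
    rw [← hwj, ← hu] at e1
    have e2 : |planeCross (F.principalDirection (initialWord ω n)) u| ≤ 1 / 32 := by
      refine e1.trans ((mul_le_mul hecc.le hj1 (div_nonneg (F.singularValue_nonneg _ _)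
        (F.singularValue_nonneg _ _)) (by positivity)).trans (le_of_eq ?_))
      field_simp
    have hn1' := F.norm_principalDirection (initialWord ω n)
    rw [planeCross_eq_of_norm_eq_one hn1' u v]
    refine (abs_sub _ _).trans ?_
    rw [abs_mul, abs_mul]
    have e3 := mul_le_mul (abs_inner_le_one hn1' hu1) hcr.le (abs_nonneg _) zero_le_one
    have e4 := mul_le_mul e2 (abs_inner_le_one hn1' hω.norm_eq_one) (abs_nonneg _) (by norm_num)
    linarith
  rw [planeCross_eq_of_norm_eq_one hu1]
  refine (abs_sub _ _).trans ?_
  rw [abs_mul, abs_mul]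
  have e1 := mul_le_mul (abs_inner_le_one hu1 hω.norm_eq_one) hPu (abs_nonneg _) zero_le_one
  have e2 : |(inner ℝ u P : ℝ)| ≤ r * t := by
    refine (abs_real_inner_le_norm _ _).trans ?_
    rw [hu1, one_mul]; exact hζL
  have e3 := mul_le_mul huv e2 (abs_nonneg _) (by norm_num)
  linarith

end AffineIFS

/-! ### Tangent sets -/

theorem eventually_exists_scenery_near {E : Set Plane} {x : Plane} {T : Set Plane} {t : ℕ → ℝ}
    (hT : Tendsto (fun n => Metric.hausdorffEDist (scenery E x (t n)) T) atTop (𝓝 0))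
    {z : Plane} (hz : z ∈ T) {ρ : ℝ} (hρ : 0 < ρ) :
    ∀ᶠ n in atTop, ∃ y ∈ E, ‖y - x‖ ≤ t n ∧ ‖(t n)⁻¹ • (y - x) - z‖ < ρ := by
  filter_upwards [hT.eventually_lt_const (ENNReal.ofReal_pos.2 hρ)] with n hn
  rw [Metric.hausdorffEDist_comm] at hn
  obtain ⟨w, ⟨y, ⟨hyE, hyt⟩, rfl⟩, hw⟩ := Metric.exists_edist_lt_of_hausdorffEDist_lt hz hn
  refine ⟨y, hyE, by rwa [← dist_eq_norm, ← Metric.mem_closedBall], ?_⟩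
  rw [← dist_eq_norm, dist_comm]
  rwa [edist_dist, ENNReal.ofReal_lt_ofReal_iff hρ] at hw

theorem mem_of_eventually_scenery_near {E : Set Plane} {x : Plane} {T : Set Plane} {t : ℕ → ℝ}
    (hc : IsClosed T)
    (hT : Tendsto (fun n => Metric.hausdorffEDist (scenery E x (t n)) T) atTop (𝓝 0))
    {z : Plane} (h : ∀ ρ : ℝ, 0 < ρ →
      ∀ᶠ n in atTop, ∃ y ∈ E, ‖y - x‖ ≤ t n ∧ ‖(t n)⁻¹ • (y - x) - z‖ ≤ ρ) : z ∈ T := by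
  rw [← hc.closure_eq, Metric.mem_closure_iff]
  intro ρ hρ
  have hρ2 : 0 < ρ / 2 := by linarith
  obtain ⟨n, ⟨y, hyE, hyt, hy⟩, hn⟩ :=
    ((h _ hρ2).and (hT.eventually_lt_const (ENNReal.ofReal_pos.2 hρ2))).exists
  obtain ⟨w, hwT, hw⟩ := Metric.exists_edist_lt_of_hausdorffEDist_lt
    (show (t n)⁻¹ • (y - x) ∈ scenery E x (t n) from
      ⟨y, ⟨hyE, by rwa [Metric.mem_closedBall, dist_eq_norm]⟩, rfl⟩) hn
  rw [edist_dist, ENNReal.ofReal_lt_ofReal_iff hρ2] at hw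
  refine ⟨w, hwT, ?_⟩
  rw [← dist_eq_norm] at hy
  calc dist z w ≤ dist z ((t n)⁻¹ • (y - x)) + dist ((t n)⁻¹ • (y - x)) w := dist_triangle _ _ _
    _ < ρ / 2 + ρ / 2 := by rw [dist_comm z]; exact add_lt_add_of_le_of_lt hy hw
    _ = ρ := by ring

theorem norm_le_one_of_mem_tangent {E : Set Plane} {x : Plane} {T : Set Plane} {t : ℕ → ℝ}
    (ht : ∀ n, 0 < t n)
    (hT : Tendsto (fun n => Metric.hausdorffEDist (scenery E x (t n)) T) atTop (𝓝 0))
    {z : Plane} (hz : z ∈ T) : ‖z‖ ≤ 1 := by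
  refine le_of_forall_pos_le_add fun ρ hρ => ?_
  obtain ⟨n, y, -, hy1, hy2⟩ := (eventually_exists_scenery_near hT hz hρ).exists
  have h1 : ‖(t n)⁻¹ • (y - x)‖ ≤ 1 := by
    rw [norm_smul, norm_inv, Real.norm_eq_abs, abs_of_pos (ht n), inv_mul_le_iff₀ (ht n), mul_one]
    exact hy1
  have h2 := norm_sub_norm_le z ((t n)⁻¹ • (y - x))
  rw [norm_sub_rev] at h2
  linarith

theorem tendsto_nhdsGT_zero {t : ℕ → ℝ} (ht : ∀ n, 0 < t n) (h : Tendsto t atTop (𝓝 0)) :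
    Tendsto t atTop (𝓝[>] 0) :=
  tendsto_nhdsWithin_iff.2 ⟨h, Eventually.of_forall ht⟩

/-- A subset of the unit disc that contains, with a point, the whole chord in the direction `v`
through it, is the rotated image of a product with a line. -/
theorem eq_rotationTo_image {v : Plane} (hv : ‖v‖ = 1) {T : Set Plane}
    (h1 : ∀ z ∈ T, ‖z‖ ≤ 1)
    (h2 : ∀ z ∈ T, ∀ w : Plane, ‖w‖ ≤ 1 → planeCross v w = planeCross v z → w ∈ T) :
    T = rotationTo v '' (planeProd univ (planeCross v '' T) ∩ Metric.closedBall 0 1) := by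
  ext w
  constructor
  · intro hw
    refine ⟨!₂[inner ℝ v w, planeCross v w], ⟨⟨mem_univ _, w, hw, by simp⟩, ?_⟩,
      rotationTo_frame hv w⟩
    rw [mem_closedBall_zero_iff, ← sq_le_one_iff₀ (norm_nonneg _), plane_norm_sq]
    simp only [Matrix.cons_val_zero, Matrix.cons_val_one]
    rw [← norm_sq_eq_inner_sq_add hv, sq_le_one_iff₀ (norm_nonneg _)]
    exact h1 w hw
  · rintro ⟨y, ⟨⟨-, z, hz, hzy⟩, hy⟩, rfl⟩
    refine h2 z hz _ ?_ (by rw [planeCross_rotationTo hv, hzy])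
    rw [mem_closedBall_zero_iff, ← sq_le_one_iff₀ (norm_nonneg _), plane_norm_sq] at hy
    rw [← sq_le_one_iff₀ (norm_nonneg _), norm_sq_eq_inner_sq_add hv, inner_rotationTo hv,
      planeCross_rotationTo hv]
    exact hy

namespace AffineIFS

variable {m : ℕ} {F : AffineIFS m} {E : Set Plane} {a β D δ : ℝ}

/-- Tangent sets at the projection of a typical word contain the chords through their points. -/
theorem IsTypical.mem_tangent {ω : ℕ → Fin m} {v : Plane}
    (h : F.HasConstants E a β D δ) (hω : F.IsTypical ω v (2 * (δ + D))) {T : Set Plane} {t : ℕ → ℝ}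
    (hc : IsClosed T) (ht : ∀ n, 0 < t n) (ht0 : Tendsto t atTop (𝓝 0))
    (hT : Tendsto (fun n => Metric.hausdorffEDist (scenery E (F.canonicalProjection ω) (t n)) T)
      atTop (𝓝 0))
    {z : Plane} (hz : z ∈ T) {w : Plane} (hw : ‖w‖ ≤ 1) (hwz : planeCross v w = planeCross v z) :
    w ∈ T := by
  have hv := hω.norm_eq_one
  have hz1 := norm_le_one_of_mem_tangent ht hT hz
  -- first the points in the interior of the disc
  have hint : ∀ w : Plane, ‖w‖ < 1 → planeCross v w = planeCross v z → w ∈ T := by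
    intro w hw hwz
    refine mem_of_eventually_scenery_near hc hT fun ρ hρ => ?_
    set ρ' := min ρ (1 - ‖w‖) with hρ'
    have hρ'0 : 0 < ρ' := lt_min hρ (by linarith)
    filter_upwards [eventually_exists_scenery_near hT hz (half_pos hρ'0),
      (tendsto_nhdsGT_zero ht ht0).eventually (hω.eventually_crossing h (half_pos hρ'0))]
      with n ⟨y, hyE, hyt, hy⟩ hcross
    have hwv : |(inner ℝ v w : ℝ)| ≤ 1 := by
      have := abs_real_inner_le_norm v w
      rw [hv, one_mul] at this
      linarith
    obtain ⟨y', hy'E, hin, hcr⟩ := hcross y hyE hyt _ hwv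
    have htn := ht n
    have hnear : ‖(t n)⁻¹ • (y' - F.canonicalProjection ω) - w‖ ≤ ρ' := by
      refine (norm_le_abs_inner_add hv _).trans ?_
      have e1 : (inner ℝ v ((t n)⁻¹ • (y' - F.canonicalProjection ω) - w) : ℝ) = 0 := by
        rw [inner_sub_right, inner_smul_right, hin]
        field_simp
        ring
      have e2 : planeCross v ((t n)⁻¹ • (y' - F.canonicalProjection ω) - w) =
          (t n)⁻¹ * planeCross v (y' - y) +
            planeCross v ((t n)⁻¹ • (y - F.canonicalProjection ω) - z) := by
        simp only [planeCross_sub_right, planeCross_smul_right, hwz]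
        ring
      have e3 : |(t n)⁻¹ * planeCross v (y' - y)| ≤ ρ' / 2 := by
        rw [abs_mul, abs_inv, abs_of_pos htn, inv_mul_le_iff₀ htn, mul_comm (t n)]
        exact hcr
      have e4 := abs_planeCross_le v ((t n)⁻¹ • (y - F.canonicalProjection ω) - z)
      rw [hv, one_mul] at e4
      rw [e1, abs_zero, zero_add, e2]
      refine (abs_add_le _ _).trans ?_
      linarith
    refine ⟨y', hy'E, ?_, hnear.trans (min_le_left _ _)⟩
    have e1 := norm_sub_norm_le ((t n)⁻¹ • (y' - F.canonicalProjection ω)) w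
    have e2 : ‖(t n)⁻¹ • (y' - F.canonicalProjection ω)‖ ≤ 1 := by
      have := min_le_right ρ (1 - ‖w‖)
      linarith
    rw [norm_smul, norm_inv, Real.norm_eq_abs, abs_of_pos htn, inv_mul_le_iff₀ htn, mul_one] at e2
    exact e2
  have hzs := norm_sq_eq_inner_sq_add hv z
  have hws := norm_sq_eq_inner_sq_add hv w
  have hz2 : ‖z‖ ^ 2 ≤ 1 := pow_le_one₀ (norm_nonneg _) hz1
  have hw2 : ‖w‖ ^ 2 ≤ 1 := pow_le_one₀ (norm_nonneg _) hw
  rcases eq_or_ne (inner ℝ v w : ℝ) 0 with h0 | h0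
  · -- `w` is the middle of its chord, hence interior unless the chord is a single point
    rcases hw.eq_or_lt with hw1 | hw1
    · have hzin : (inner ℝ v z : ℝ) = 0 := by
        rw [hw1, h0, hwz] at hws
        have : (inner ℝ v z : ℝ) ^ 2 ≤ 0 := by linarith
        exact pow_eq_zero_iff two_ne_zero |>.1 (le_antisymm this (sq_nonneg _))
      have : w = z := by
        rw [← rotationTo_frame hv w, ← rotationTo_frame hv z, h0, hzin, hwz]
      rwa [this]
    · exact hint w hw1 hwz
  · -- `w` is a limit of points in the interior of its chord
    let wl : ℝ → Plane := fun l => w - (l * (inner ℝ v w : ℝ)) • v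
    have hwl : Tendsto wl (𝓝[>] 0) (𝓝 w) := by
      have : Continuous wl := by fun_prop
      have h1 := this.tendsto 0
      simp only [wl, zero_mul, zero_smul, sub_zero] at h1
      exact h1.mono_left nhdsWithin_le_nhds
    refine hc.mem_of_tendsto hwl ?_
    filter_upwards [Ioo_mem_nhdsGT one_pos] with l hl
    have e1 : planeCross v (wl l) = planeCross v w := by
      simp only [wl, planeCross_sub_right, planeCross_smul_right, planeCross_self, mul_zero, sub_zero]
    have e2 : (inner ℝ v (wl l) : ℝ) = (1 - l) * inner ℝ v w := by
      simp only [wl]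
      rw [inner_sub_right, inner_smul_right, real_inner_self_eq_norm_sq, hv]
      ring
    refine hint _ ?_ (e1.trans hwz)
    rw [← sq_lt_one_iff₀ (norm_nonneg _), norm_sq_eq_inner_sq_add hv, e1, e2, mul_pow]
    have h3 : (1 - l) ^ 2 < 1 := by nlinarith [hl.1, hl.2]
    have h4 : 0 < (inner ℝ v w : ℝ) ^ 2 := by positivity
    nlinarith

/-- The fibres of the tangent sets are porous: a fibre without holes of the relative size `α` would
give rise to a chain of points of `E` with small steps, which has a large height. -/
theorem IsTypical.isPorous_fibre {ω : ℕ → Fin m} {v : Plane}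
    (h : F.HasConstants E a β D δ) (hω : F.IsTypical ω v (2 * (δ + D))) {T : Set Plane} {t : ℕ → ℝ}
    (hc : IsClosed T) (ht : ∀ n, 0 < t n) (ht0 : Tendsto t atTop (𝓝 0))
    (hT : Tendsto (fun n => Metric.hausdorffEDist (scenery E (F.canonicalProjection ω) (t n)) T)
      atTop (𝓝 0)) :
    IsPorous (planeCross v '' T) := by
  have hv := hω.norm_eq_one
  obtain ⟨κ, hκ0, hκ⟩ := hω.exists_chain_bound h
  obtain ⟨L, hL3, hLκ⟩ : ∃ L : ℕ, 3 ≤ L ∧ 3 / κ ≤ L := by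
    obtain ⟨L, hL⟩ := exists_nat_ge (3 / κ)
    exact ⟨max L 3, le_max_right _ _, hL.trans (by exact_mod_cast le_max_left _ _)⟩
  have hL3' : (3 : ℝ) ≤ L := by exact_mod_cast hL3
  rw [div_le_iff₀ hκ0] at hLκ
  -- the chain has `L` steps and total height about `2 α L r = L r / (L + 2)`
  set α : ℝ := 1 / (2 * (L + 2)) with hα
  have hα0 : 0 < α := by positivity
  have hαL : α * (2 * (L + 2)) = 1 := by rw [hα]; field_simp
  have hακ : 6 * α ≤ κ := by
    have : 6 * (α * (2 * (L + 2))) ≤ κ * (2 * (L + 2)) := by rw [hαL]; linarith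
    rw [← mul_assoc] at this
    exact le_of_mul_le_mul_right this (by positivity)
  have hα1 : α ≤ 1 := by nlinarith
  have hCle : ∀ c ∈ planeCross v '' T, |c| ≤ 1 := by
    rintro _ ⟨z, hz, rfl⟩
    have h1 := abs_planeCross_le v z
    rw [hv, one_mul] at h1
    exact h1.trans (norm_le_one_of_mem_tangent ht hT hz)
  refine ⟨α / 2, by positivity, by linarith, fun c hcC r₂ hr₂ hdiam => ?_⟩
  have hr₂2 : r₂ ≤ 2 := by
    by_contra! hgt
    have : Metric.ediam (planeCross v '' T) ≤ ENNReal.ofReal 2 := by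
      refine Metric.ediam_le fun x hx y hy => ?_
      rw [edist_dist]
      refine ENNReal.ofReal_le_ofReal ?_
      rw [Real.dist_eq]
      exact (abs_sub _ _).trans (by linarith [hCle x hx, hCle y hy])
    exact absurd (hdiam.trans_le this) (not_lt.2 (ENNReal.ofReal_le_ofReal hgt.le))
  obtain ⟨r, hr⟩ : ∃ r, r₂ = 2 * r := ⟨r₂ / 2, by ring⟩
  subst hr
  have hr0 : 0 < r := by linarith
  have hr1 : r ≤ 1 := by linarith
  by_contra! hhole
  have hcl : ∀ l : ℕ, ∃ e : ℝ, l ≤ L → e ∈ planeCross v '' T ∧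
      c + 2 * l * α * r ≤ e ∧ e ≤ c + 2 * (l + 1) * α * r := by
    intro l
    by_cases hl : l ≤ L
    · have hl' : (l : ℝ) ≤ L := by exact_mod_cast hl
      have hmem : Metric.closedBall (c + (2 * l + 1) * α * r) (α / 2 * (2 * r)) ⊆
          Metric.closedBall c (2 * r) := by
        refine Metric.closedBall_subset_closedBall' ?_
        have h1 : (2 * l + 2) * (α * r) ≤ (2 * L + 4) * (α * r) :=
          mul_le_mul_of_nonneg_right (by linarith) (by positivity)
        have h2 : (2 * L + 4) * (α * r) = r := by linear_combination r * hαL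
        rw [Real.dist_eq, add_sub_cancel_left, abs_of_pos (by positivity)]
        linarith
      obtain ⟨e, he, heC⟩ := not_subset.1 (hhole (c + (2 * l + 1) * α * r))
      have heC' : e ∈ planeCross v '' T := by
        by_contra hcon
        exact heC ⟨hmem he, hcon⟩
      rw [Metric.mem_closedBall, Real.dist_eq, abs_le] at he
      exact ⟨e, fun _ => ⟨heC', by linarith [he.1], by linarith [he.2]⟩⟩
    · exact ⟨0, fun h => absurd h hl⟩
  choose e he using hcl
  -- the points of the fibre over `0` at the heights `e l` belong to `T`
  let J : Plane := !₂[-v 1, v 0]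
  have hJcr : planeCross v J = 1 := by
    have h1 := plane_norm_sq v
    rw [hv] at h1
    simp only [planeCross, J, Matrix.cons_val_zero, Matrix.cons_val_one]
    linear_combination -h1
  have hJin : (inner ℝ v J : ℝ) = 0 := by
    rw [plane_inner_eq]
    simp only [J, Matrix.cons_val_zero, Matrix.cons_val_one]
    ring
  have hJ1 : ‖J‖ = 1 := by
    have h1 := norm_sq_eq_inner_sq_add hv J
    rw [hJcr, hJin] at h1
    rw [← sq_eq_sq₀ (norm_nonneg _) zero_le_one, h1]; norm_num
  have hTl : ∀ l ≤ L, e l • J ∈ T := by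
    intro l hl
    obtain ⟨⟨z, hz, hze⟩, -, -⟩ := he l hl
    refine hω.mem_tangent h hc ht ht0 hT hz ?_ (by
      rw [planeCross_smul_right, hJcr, mul_one, hze])
    rw [norm_smul, hJ1, mul_one, Real.norm_eq_abs]
    exact hCle _ (he l hl).1
  have hαr : 0 < α * r := by positivity
  have hnear : ∀ᶠ n in atTop, ∀ l ∈ Finset.range (L + 1), ∃ y ∈ E,
      ‖y - F.canonicalProjection ω‖ ≤ t n ∧
      ‖(t n)⁻¹ • (y - F.canonicalProjection ω) - e l • J‖ < α * r :=
    (Filter.eventually_all_finset _).2 fun l hl => eventually_exists_scenery_near hT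
      (hTl l (by have := Finset.mem_range.1 hl; omega)) hαr
  obtain ⟨n, hn, hchain⟩ :=
    (hnear.and ((tendsto_nhdsGT_zero ht ht0).eventually (hκ r hr0 hr1))).exists
  have htn := ht n
  have hζ : ∀ l : ℕ, ∃ ξ : ℕ → Fin m, l ≤ L →
      ‖F.canonicalProjection ξ - F.canonicalProjection ω‖ ≤ t n ∧
      ‖F.canonicalProjection ξ - F.canonicalProjection ω - (t n * e l) • J‖ ≤ α * r * t n := by
    intro l
    by_cases hl : l ≤ L
    · obtain ⟨y, hyE, hy1, hy2⟩ := hn l (Finset.mem_range.2 (by omega))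
      rw [← h.isSelfAffineSet.range_canonicalProjection] at hyE
      obtain ⟨ξ, rfl⟩ := hyE
      refine ⟨ξ, fun _ => ⟨hy1, ?_⟩⟩
      have e1 : F.canonicalProjection ξ - F.canonicalProjection ω - (t n * e l) • J =
          t n • ((t n)⁻¹ • (F.canonicalProjection ξ - F.canonicalProjection ω) - e l • J) := by
        rw [smul_sub, smul_smul, smul_smul, mul_inv_cancel₀ htn.ne', one_smul]
      rw [e1, norm_smul, Real.norm_eq_abs, abs_of_pos htn, mul_comm]
      exact mul_le_mul_of_nonneg_right hy2.le htn.le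
    · exact ⟨ω, fun h => absurd h hl⟩
  choose ζ hζ using hζ
  have hdiff : ∀ l k : ℕ, l ≤ L → k ≤ L →
      ‖F.canonicalProjection (ζ l) - F.canonicalProjection (ζ k) - (t n * (e l - e k)) • J‖ ≤
        2 * (α * r * t n) := by
    intro l k hl hk
    have e1 : F.canonicalProjection (ζ l) - F.canonicalProjection (ζ k) - (t n * (e l - e k)) • J =
        (F.canonicalProjection (ζ l) - F.canonicalProjection ω - (t n * e l) • J) -
        (F.canonicalProjection (ζ k) - F.canonicalProjection ω - (t n * e k) • J) := by
      rw [mul_sub, sub_smul]; abel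
    rw [e1]
    exact (norm_sub_le _ _).trans (by linarith [(hζ l hl).2, (hζ k hk).2])
  have hdist : ∀ l k : ℕ, l ≤ L → k ≤ L →
      ‖F.canonicalProjection (ζ l) - F.canonicalProjection (ζ k)‖ ≤
        t n * |e l - e k| + 2 * (α * r * t n) := by
    intro l k hl hk
    have h1 := norm_sub_norm_le (F.canonicalProjection (ζ l) - F.canonicalProjection (ζ k))
      ((t n * (e l - e k)) • J)
    rw [norm_smul, hJ1, mul_one, Real.norm_eq_abs, abs_mul, abs_of_pos htn] at h1
    linarith [hdiff l k hl hk]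
  have hrt : 0 < r * t n := by positivity
  have hbound := hchain ζ L (hζ 0 (Nat.zero_le _)).1 (fun l hl => ?_) ?_
  · -- the height of the chain contradicts the bound
    have h1 := hdiff L 0 le_rfl (Nat.zero_le _)
    have h2 := abs_planeCross_le v (F.canonicalProjection (ζ L) - F.canonicalProjection (ζ 0) -
      (t n * (e L - e 0)) • J)
    rw [hv, one_mul, planeCross_sub_right, planeCross_smul_right, hJcr, mul_one] at h2
    have h3 := (abs_le.1 (h2.trans h1)).1
    have h4 := (abs_le.1 hbound).2
    have h5 := (he L le_rfl).2.1
    have h6 := (he 0 (Nat.zero_le _)).2.2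
    simp only [Nat.cast_zero, zero_add, mul_one] at h6
    have h7 : (2 * L - 2) * α * r ≤ e L - e 0 := by linarith
    have h8 := mul_le_mul_of_nonneg_left h7 htn.le
    have h9 : (2 * L - 4) * α * (r * t n) ≤ r * t n / 8 := by linarith
    have h10 : (2 * L - 4) * α ≤ 1 / 8 := by
      refine le_of_mul_le_mul_right ?_ hrt
      linarith
    nlinarith
  · have h1 := he l (by omega)
    have h2 := he (l + 1) (by omega)
    have h3 : |e (l + 1) - e l| ≤ 4 * (α * r) := by
      have h4 := h1.2.1
      have h5 := h1.2.2
      have h6 := h2.2.1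
      have h7 := h2.2.2
      push_cast at h6 h7
      rw [abs_le]
      constructor <;> linarith
    refine (hdist (l + 1) l (by omega) (by omega)).trans ?_
    have h8 := mul_le_mul_of_nonneg_left h3 htn.le
    have h9 := mul_le_mul_of_nonneg_right hακ hrt.le
    linarith
  · have h1 := he 0 (Nat.zero_le _)
    have h2 := he L le_rfl
    simp only [Nat.cast_zero, zero_add, mul_one, mul_zero, zero_mul, add_zero] at h1
    have h3 : |e L - e 0| ≤ (2 * L + 2) * (α * r) := by
      have h4 : 0 ≤ (2 * L - 2) * (α * r) := mul_nonneg (by linarith) hαr.le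
      rw [abs_le]
      constructor <;> linarith [h1.2.1, h1.2.2, h2.2.1, h2.2.2]
    refine (hdist L 0 le_rfl (Nat.zero_le _)).trans ?_
    have h5 := mul_le_mul_of_nonneg_left h3 htn.le
    have h6 : (2 * L + 2) * α + 2 * α = 1 := by linarith
    have h7 : t n * ((2 * L + 2) * (α * r)) + 2 * (α * r * t n) = r * t n := by
      linear_combination (r * t n) * h6
    linarith

/-- Tangent sets at the projection of a typical word are fibred over a porous set. -/
theorem IsTypical.exists_fibre {ω : ℕ → Fin m} {v : Plane}
    (h : F.HasConstants E a β D δ) (hω : F.IsTypical ω v (2 * (δ + D))) {T : Set Plane}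
    (hT : IsTangentSet E (F.canonicalProjection ω) T) :
    ∃ C : Set ℝ, IsClosed C ∧ IsPorous C ∧
      T = rotationTo v '' (planeProd univ C ∩ Metric.closedBall 0 1) := by
  obtain ⟨hcomp, -, t, ht, -, ht0, hlim⟩ := hT
  exact ⟨planeCross v '' T, (hcomp.image (continuous_planeCross v)).isClosed,
    hω.isPorous_fibre h hcomp.isClosed ht ht0 hlim,
    eq_rotationTo_image hω.norm_eq_one (fun z hz => norm_le_one_of_mem_tangent ht hlim hz)
      fun z hz w hw hwz => hω.mem_tangent h hcomp.isClosed ht ht0 hlim hz hw hwz⟩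

/-- Almost every infinite word has a limiting direction and is typical for each of them. -/
theorem ae_isTypical (hm : 2 ≤ m) (hE : F.IsSelfAffineSet E) (p : PMF (Fin m)) (hp : ∀ i, 0 < p i)
    (hsep : F.StrongSeparation E)
    (hproj : ∀ᵐ ω ∂(bernoulliMeasure p), ∀ v : Plane, F.IsLimitDirection ω v →
      ∃ n₀ : ℕ, ∀ n ≥ n₀, ∀ w : List (Fin m),
        IsLineSegment (projOnto v (F.cylinder E (initialWord ω n ++ w))))
    (hlyap : F.lyapunovExponent p 0 < F.lyapunovExponent p 1) {K : ℝ} (hK : 0 < K) :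
    ∀ᵐ ω ∂(bernoulliMeasure p), (∃ v, F.IsLimitDirection ω v) ∧
      ∀ v, F.IsLimitDirection ω v → F.IsTypical ω v K := by
  obtain ⟨c₀, hc₀, hecc⟩ := F.ae_eventually_eccentricity_le p hlyap
  have hgeo : Summable fun n : ℕ => Real.exp (-(c₀ * n)) := by
    have : (fun n : ℕ => Real.exp (-(c₀ * n))) = fun n : ℕ => Real.exp (-c₀) ^ n := by
      funext n; rw [← Real.exp_nat_mul]; ring_nf
    rw [this]
    exact summable_geometric_of_lt_one (Real.exp_pos _).le (Real.exp_lt_one_iff.2 (by linarith))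
  have hsum : ∀ᵐ ω ∂(bernoulliMeasure p),
      Summable fun n => F.eccentricity (initialWord ω n) := by
    filter_upwards [hecc] with ω hω
    refine Summable.of_norm_bounded_eventually_nat hgeo ?_
    filter_upwards [hω] with n hn
    rwa [Real.norm_eq_abs, abs_of_pos (F.eccentricity_pos _)]
  obtain ⟨ℓ, hℓ, hwidth⟩ : ∃ ℓ : ℝ, 0 < ℓ ∧ ∀ η : Plane, ‖η‖ = 1 → ∃ ω ω' : ℕ → Fin m,
      ℓ ≤ inner ℝ η (F.canonicalProjection ω - F.canonicalProjection ω') := by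
    obtain ⟨ω, hω, hω'⟩ := (hsum.and hproj).exists
    obtain ⟨v, hv⟩ := F.exists_isLimitDirection hω
    obtain ⟨n₀, hn₀⟩ := hω' v hv
    exact exists_width (exists_planeCross_ne_zero hm hE hsep (hn₀ n₀ le_rfl []))
  obtain ⟨C, s, hC, hs, hstrip⟩ := F.exists_measure_stripWords_le p hp hℓ hwidth
  have hend := ae_all_iff.2 fun J =>
    F.ae_eventually_noEndNear p hC hs hstrip hK hc₀ J
  filter_upwards [hecc, hsum, hproj, hend] with ω h1 h2 h3 h4
  refine ⟨F.exists_isLimitDirection h2, fun v hv => ?_⟩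
  obtain ⟨n₀, hn₀⟩ := h3 v hv
  exact
    { norm_eq_one := hv.norm_eq_one
      tendsto_eccentricity := h2.tendsto_atTop_zero
      tendsto_planeCross := hv.tendsto_planeCross h2.tendsto_atTop_zero
      isPreconnected := by
        filter_upwards [eventually_ge_atTop n₀] with n hn w
        exact isPreconnected_range_inner hE (hn₀ n hn w)
      noEndNear := fun J => by
        filter_upwards [h1, h4 J] with n hn1 hn2
        exact hn2 hn1 }

end AffineIFS

theorem theorem3p1 {m : ℕ} (hm : 2 ≤ m) (F : AffineIFS m) (E : Set Plane)
    (hE : F.IsSelfAffineSet E)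
    (p : PMF (Fin m)) (hp : ∀ i, 0 < p i)
    (hsep : F.StrongSeparation E)
    (hproj : ∀ᵐ ω ∂(AffineIFS.bernoulliMeasure p), ∀ v : Plane, F.IsLimitDirection ω v →
      ∃ n₀ : ℕ, ∀ n ≥ n₀, ∀ w : List (Fin m),
        IsLineSegment (projOnto v (F.cylinder E (AffineIFS.initialWord ω n ++ w))))
    (hlyap : F.lyapunovExponent p 0 < F.lyapunovExponent p 1) :
    ∀ᵐ x ∂((AffineIFS.bernoulliMeasure p).map F.canonicalProjection),
      x ∈ E ∧ ∃ ω : ℕ → Fin m, F.canonicalProjection ω = x ∧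
        (∃ v : Plane, F.IsLimitDirection ω v) ∧
        ∀ v : Plane, F.IsLimitDirection ω v → ∀ T : Set Plane, IsTangentSet E x T →
          (∃ C : Set ℝ, IsClosed C ∧ IsPorous C ∧
            T = rotationTo v '' (planeProd univ C ∩ Metric.closedBall 0 1)) ∨
          (∃ l : Set ℝ, l.OrdConnected ∧ (Icc (-1) 0 ⊆ l ∨ Icc 0 1 ⊆ l) ∧
            T = rotationTo v '' (planeProd l {0} ∩ Metric.closedBall 0 1)) := by
  obtain ⟨a, β, D, δ, h⟩ := AffineIFS.exists_hasConstants hE hsep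
  have hemb : MeasurableEmbedding F.canonicalProjection :=
    F.continuous_canonicalProjection.measurable.measurableEmbedding
      (AffineIFS.canonicalProjection_injective hE hsep)
  rw [hemb.ae_map_iff]
  have hK : 0 < 2 * (δ + D) := by linarith [h.δ_pos, h.D_pos]
  filter_upwards [AffineIFS.ae_isTypical hm hE p hp hsep hproj hlyap hK] with ω ⟨hex, htyp⟩
  exact ⟨hE.canonicalProjection_mem ω, ω, rfl, hex, fun v hv T hT =>
    Or.inl ((htyp v hv).exists_fibre h hT)⟩
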